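/- Let $N_B$ and $N_F$ be lattices (free abelian groups of finite rank), put $N=N_B\times N_F$, and let $T_B$, $T_F$ and $T=T_B\times T_F$ be the complex algebraic tori with cocharacter lattices $N_B$, $N_F$ and $N$. Let $\Sigma_B$ and $\Sigma_F$ be rational polyhedral fans in $(N_B)_{\mathbb R}$ and $(N_F)_{\mathbb R}$, that is, finite non-empty sets of strongly convex rational polyhedral cones that contain all faces of their members and in which any two members meet in a common face; write $|\Sigma_B|$ for the union of the cones of $\Sigma_B$, and $X_\Sigma$ for the complex toric variety of a fan $\Sigma$. A twisting map on $\Sigma_B$ is a map $\Phi:|\Sigma_B|\to (N_F)_{\mathbb R}$ whose restriction to every cone of $\Sigma_B$ is the restriction of the linear map induced by some homomorphism $N_B\to N_F$. The twisted product is the fan in $N_{\mathbb R}$ $$\Sigma_B\ltimes_\Phi\Sigma_F=\{\widetilde\sigma+\tau \mid \sigma\in\Sigma_B,\ \tau\in\Sigma_F\},\qquad \widetilde\sigma=\{(x,\Phi(x))\mid x\in\sigma\},$$ where $\tau$ is regarded as the cone $\{0\}\times\tau$. The projection $N\to N_B$ induces a toric morphism $\pi_\Phi: X_{\Sigma_B\ltimes_\Phi\Sigma_F}\to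 X_{\Sigma_B}$, which is a Zariski-locally trivial bundle with fibre $X_{\Sigma_F}$; with it, $X_{\Sigma_B\ltimes_\Phi\Sigma_F}$ is a fibered toric variety over $X_{\Sigma_B}$. Let $\Phi,\Phi'$ be twisting maps on $\Sigma_B$ that differ by a global linear map: there is $\varphi\in\mathrm{Hom}(N_B,N_F)$ with $\Phi'(x)=\Phi(x)+\varphi(x)$ for all $x\in|\Sigma_B|$. Put $\Sigma=\Sigma_B\ltimes_\Phi\Sigma_F$ and $\Sigma'=\Sigma_B\ltimes_{\Phi'}\Sigma_F$. Then $X_\Sigma$ and $X_{\Sigma'}$ are isomorphic as fibered toric varieties over $X_{\Sigma_B}$. More precisely, the lattice automorphism $$\widetilde\varphi: N\to N,\qquad (v_1,v_2)\mapsto (v_1,\,v_2+\varphi(v_1)),$$ is a map of fans from $\Sigma$ to $\Sigma'$, and the toric morphism $f: X_\Sigma\to X_{\Sigma'}$ that it induces is an isomorphism of schemes over $\mathbb C$ which satisfies $\pi_{\Phi'}\circ f=\pi_\Phi$, restricts on $T$ to the automorphism of $T$ induced by $\widetilde\varphi$, and is equivariant along this automorphism of $T$. -/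

import Mathlib

open CategoryTheory CategoryTheory.Limits AlgebraicGeometry
open scoped TensorProduct

noncomputable section

namespace Toric

/-! ### Lattices, cones and fans -/

section Lattice

variable (N : Type) [AddCommGroup N]

/-- The real vector space `N_ℝ = ℝ ⊗ N` of a lattice `N`. -/
abbrev RealSpace : Type := ℝ ⊗[ℤ] N

/-- The dual lattice `M = Hom(N, ℤ)`. -/
abbrev DualLattice : Type := Module.Dual ℤ N

end Lattice

variable {N N' N'' : Type} [AddCommGroup N] [AddCommGroup N'] [AddCommGroup N'']

/-- The pairing `⟨m, ·⟩ : N_ℝ → ℝ` of an element `m` of the dual lattice. -/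
def pairing (m : DualLattice N) : RealSpace N →ₗ[ℝ] ℝ :=
  Module.Dual.baseChange ℝ m

lemma pairing_tmul (m : DualLattice N) (r : ℝ) (v : N) :
    pairing m (r ⊗ₜ[ℤ] v) = r * (m v : ℝ) := by
  simp [pairing, mul_comm]

lemma pairing_add (m m' : DualLattice N) (x : RealSpace N) :
    pairing (m + m') x = pairing m x + pairing m' x := by
  simp [pairing]

lemma pairing_zero (x : RealSpace N) : pairing (0 : DualLattice N) x = 0 := by
  simp [pairing]

lemma pairing_baseChange (φ : N →ₗ[ℤ] N') (m : DualLattice N') (x : RealSpace N) :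
    pairing m (φ.baseChange ℝ x) = pairing (m ∘ₗ φ) x := by
  induction x using TensorProduct.induction_on with
  | zero => simp
  | tmul r v => simp [pairing_tmul]
  | add a b ha hb => simp [ha, hb]

/-- A rational polyhedral cone: generated by finitely many lattice vectors. -/
def IsRational (σ : PointedCone ℝ (RealSpace N)) : Prop :=
  ∃ S : Finset N, σ = PointedCone.hull ℝ ((fun v : N => (1 : ℝ) ⊗ₜ[ℤ] v) '' S)

lemma IsRational.map {σ : PointedCone ℝ (RealSpace N)} (hσ : IsRational σ) (φ : N →ₗ[ℤ] N') :
    IsRational (PointedCone.map (φ.baseChange ℝ) σ) := by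
  classical
  obtain ⟨S, rfl⟩ := hσ
  refine ⟨S.image φ, ?_⟩
  rw [PointedCone.map, PointedCone.hull, Submodule.map_span, PointedCone.hull, Finset.coe_image,
    Set.image_image, Set.image_image]
  congr 1

lemma IsRational.sup {σ τ : PointedCone ℝ (RealSpace N)} (hσ : IsRational σ)
    (hτ : IsRational τ) : IsRational (σ ⊔ τ) := by
  classical
  obtain ⟨S, rfl⟩ := hσ
  obtain ⟨T, rfl⟩ := hτ
  refine ⟨S ∪ T, ?_⟩
  rw [PointedCone.hull, PointedCone.hull, PointedCone.hull, Finset.coe_union, Set.image_union,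
    Submodule.span_union]

/-- `τ` is a face of the rational cone `σ`: it is cut out in `σ` by the hyperplane `m = 0`
for a lattice functional `m` that is non-negative on `σ`. -/
def IsFace (τ σ : PointedCone ℝ (RealSpace N)) : Prop :=
  ∃ m : DualLattice N, (∀ x ∈ σ, 0 ≤ pairing m x) ∧ ∀ x, x ∈ τ ↔ x ∈ σ ∧ pairing m x = 0

lemma isFace_cut {σ : PointedCone ℝ (RealSpace N)} {m : DualLattice N}
    (hm : ∀ x ∈ σ, 0 ≤ pairing m x) :
    IsFace (σ ⊓ PointedCone.ofSubmodule (LinearMap.ker (pairing m))) σ :=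
  ⟨m, hm, fun _ => Iff.rfl⟩

variable (N) in
/-- A rational polyhedral fan in `N_ℝ`: a finite non-empty set of strongly convex rational
polyhedral cones, closed under faces, any two of which meet in a common face.
(Non-emptiness is expressed by containing the zero cone, which is a face of every cone.) -/
structure Fan where
  cones : Set (PointedCone ℝ (RealSpace N))
  finite : cones.Finite
  bot_mem : ⊥ ∈ cones
  rational : ∀ σ ∈ cones, IsRational σ
  salient : ∀ σ ∈ cones, (σ : ConvexCone ℝ (RealSpace N)).Salient
  face_mem : ∀ σ ∈ cones, ∀ τ, IsFace τ σ → τ ∈ cones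
  inf_isFace : ∀ σ ∈ cones, ∀ τ ∈ cones, IsFace (σ ⊓ τ) σ

namespace Fan

/-- The support `|Σ|`: the union of the cones. -/
def support (F : Fan N) : Set (RealSpace N) := ⋃ σ ∈ F.cones, (σ : Set (RealSpace N))

lemma mem_support {F : Fan N} {σ : PointedCone ℝ (RealSpace N)} (hσ : σ ∈ F.cones)
    {x : RealSpace N} (hx : x ∈ σ) : x ∈ F.support :=
  Set.mem_biUnion hσ hx

lemma inf_mem (F : Fan N) {σ τ : PointedCone ℝ (RealSpace N)} (hσ : σ ∈ F.cones)
    (hτ : τ ∈ F.cones) : σ ⊓ τ ∈ F.cones :=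
  F.face_mem σ hσ _ (F.inf_isFace σ hσ τ hτ)

lemma isFace_of_le (F : Fan N) {σ τ : PointedCone ℝ (RealSpace N)} (hσ : σ ∈ F.cones)
    (hτ : τ ∈ F.cones) (h : τ ≤ σ) : IsFace τ σ := by
  have := F.inf_isFace σ hσ τ hτ
  rwa [inf_eq_right.mpr h] at this

end Fan

/-! ### Affine charts -/

/-- The semigroup `S_σ = σ^∨ ∩ M`. -/
def semigroup (σ : PointedCone ℝ (RealSpace N)) : AddSubmonoid (DualLattice N) where
  carrier := {m | ∀ x ∈ σ, 0 ≤ pairing m x}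
  zero_mem' := fun x _ => (pairing_zero x).ge
  add_mem' := fun {a b} ha hb x hx => by
    rw [pairing_add]; exact add_nonneg (ha x hx) (hb x hx)

/-- The semigroup algebra `ℂ[S_σ]`. -/
abbrev chartRing (σ : PointedCone ℝ (RealSpace N)) : Type :=
  AddMonoidAlgebra ℂ (semigroup σ)

/-- The affine toric variety `U_σ = Spec ℂ[S_σ]`. -/
abbrev chart (σ : PointedCone ℝ (RealSpace N)) : Scheme.{0} :=
  Spec (CommRingCat.of (chartRing σ))

/-- `φ_ℝ` maps the cone `σ` into the cone `σ'`. -/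
def MapsCone (φ : N →ₗ[ℤ] N') (σ : PointedCone ℝ (RealSpace N))
    (σ' : PointedCone ℝ (RealSpace N')) : Prop :=
  ∀ x ∈ σ, φ.baseChange ℝ x ∈ σ'

lemma MapsCone.comp {φ : N →ₗ[ℤ] N'} {ψ : N' →ₗ[ℤ] N''} {σ : PointedCone ℝ (RealSpace N)}
    {σ' : PointedCone ℝ (RealSpace N')} {σ'' : PointedCone ℝ (RealSpace N'')}
    (h : MapsCone φ σ σ') (h' : MapsCone ψ σ' σ'') : MapsCone (ψ ∘ₗ φ) σ σ'' := by
  intro x hx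
  rw [LinearMap.baseChange_comp]
  exact h' _ (h x hx)

lemma MapsCone.of_le {σ τ : PointedCone ℝ (RealSpace N)} (h : σ ≤ τ) :
    MapsCone LinearMap.id σ τ := by
  intro x hx
  rw [LinearMap.baseChange_id]
  exact h hx

/-- The homomorphism `S_σ' → S_σ`, `m ↦ m ∘ φ`, for `φ_ℝ(σ) ⊆ σ'`. -/
def semigroupMap (φ : N →ₗ[ℤ] N') {σ : PointedCone ℝ (RealSpace N)}
    {σ' : PointedCone ℝ (RealSpace N')} (h : MapsCone φ σ σ') :
    semigroup σ' →+ semigroup σ where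
  toFun m := ⟨m.1 ∘ₗ φ, fun x hx => by
    rw [← pairing_baseChange]; exact m.2 _ (h x hx)⟩
  map_zero' := rfl
  map_add' _ _ := rfl

/-- The morphism `U_σ → U_σ'`, given by `χ^m ↦ χ^(m ∘ φ)`, for `φ_ℝ(σ) ⊆ σ'`. -/
def chartMap (φ : N →ₗ[ℤ] N') {σ : PointedCone ℝ (RealSpace N)}
    {σ' : PointedCone ℝ (RealSpace N')} (h : MapsCone φ σ σ') : chart σ ⟶ chart σ' :=
  Spec.map (CommRingCat.ofHom (AddMonoidAlgebra.mapDomainRingHom ℂ (semigroupMap φ h)))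

lemma chartMap_comp {φ : N →ₗ[ℤ] N'} {ψ : N' →ₗ[ℤ] N''} {σ : PointedCone ℝ (RealSpace N)}
    {σ' : PointedCone ℝ (RealSpace N')} {σ'' : PointedCone ℝ (RealSpace N'')}
    (h : MapsCone φ σ σ') (h' : MapsCone ψ σ' σ'') :
    chartMap φ h ≫ chartMap ψ h' = chartMap (ψ ∘ₗ φ) (h.comp h') := by
  rw [chartMap, chartMap, ← Spec.map_comp, ← CommRingCat.ofHom_comp,
    ← AddMonoidAlgebra.mapDomainRingHom_comp]
  rfl

lemma chartMap_congr {φ ψ : N →ₗ[ℤ] N'} (e : φ = ψ) {σ : PointedCone ℝ (RealSpace N)}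
    {σ' : PointedCone ℝ (RealSpace N')} (h : MapsCone φ σ σ') (h' : MapsCone ψ σ σ') :
    chartMap φ h = chartMap ψ h' := by
  subst e; rfl

lemma chartMap_id_comp {φ : N →ₗ[ℤ] N'} {σ τ : PointedCone ℝ (RealSpace N)}
    {σ' : PointedCone ℝ (RealSpace N')} (h : MapsCone LinearMap.id σ τ) (h' : MapsCone φ τ σ')
    (h'' : MapsCone φ σ σ') : chartMap LinearMap.id h ≫ chartMap φ h' = chartMap φ h'' := by
  rw [chartMap_comp]
  exact chartMap_congr (LinearMap.comp_id φ) _ _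

lemma chartMap_comp_id {φ : N →ₗ[ℤ] N'} {σ : PointedCone ℝ (RealSpace N)}
    {σ' τ' : PointedCone ℝ (RealSpace N')} (h : MapsCone φ σ σ') (h' : MapsCone LinearMap.id σ' τ')
    (h'' : MapsCone φ σ τ') : chartMap φ h ≫ chartMap LinearMap.id h' = chartMap φ h'' := by
  rw [chartMap_comp]
  exact chartMap_congr (LinearMap.id_comp φ) _ _

lemma chartMap_id {σ : PointedCone ℝ (RealSpace N)} (h : MapsCone LinearMap.id σ σ) :
    chartMap LinearMap.id h = 𝟙 (chart σ) := by
  have : semigroupMap LinearMap.id h = AddMonoidHom.id (semigroup σ) := rfl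
  rw [chartMap, this, AddMonoidAlgebra.mapDomainRingHom_id]
  exact Spec.map_id _

/-! ### The inclusion of the chart of a face is a principal open immersion -/

lemma exists_add_nsmul_mem {σ τ : PointedCone ℝ (RealSpace N)} (hσ : IsRational σ)
    {m : DualLattice N} (hm : ∀ x ∈ σ, 0 ≤ pairing m x)
    (hτ : ∀ x, x ∈ τ ↔ x ∈ σ ∧ pairing m x = 0) (m' : DualLattice N) (hm' : m' ∈ semigroup τ) :
    ∃ k : ℕ, m' + k • m ∈ semigroup σ := by
  obtain ⟨S, hS⟩ := hσ
  refine ⟨∑ v ∈ S, (m' v).natAbs, ?_⟩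
  set k := ∑ v ∈ S, (m' v).natAbs with hk
  have key : ∀ v ∈ S, 0 ≤ (m' + k • m) v := by
    intro v hv
    have hvσ : (1 : ℝ) ⊗ₜ[ℤ] v ∈ σ := by
      rw [hS]; exact Submodule.subset_span ⟨v, hv, rfl⟩
    have h0 : 0 ≤ m v := by
      have := hm _ hvσ
      rw [pairing_tmul, one_mul] at this
      exact_mod_cast this
    have hkv : (m' v).natAbs ≤ k :=
      Finset.single_le_sum (f := fun v => (m' v).natAbs) (fun _ _ => Nat.zero_le _) hv
    simp only [LinearMap.add_apply, LinearMap.smul_apply, nsmul_eq_mul]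
    rcases h0.eq_or_lt with h0 | h0
    · have hvτ : (1 : ℝ) ⊗ₜ[ℤ] v ∈ τ := by
        rw [hτ, pairing_tmul, ← h0]; simpa using hvσ
      have := hm' _ hvτ
      rw [pairing_tmul, one_mul] at this
      have : 0 ≤ m' v := by exact_mod_cast this
      rw [← h0]; simpa using this
    · have h1 : (k : ℤ) ≤ k * m v := by nlinarith [Int.natCast_nonneg k]
      omega
  intro x hx
  rw [hS] at hx
  induction hx using Submodule.span_induction with
  | mem y hy =>
    obtain ⟨v, hv, rfl⟩ := hy
    simp only [pairing_tmul, one_mul]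
    exact_mod_cast key v hv
  | zero => simp
  | add a b _ _ ha hb => rw [map_add]; exact add_nonneg ha hb
  | smul r a _ ha =>
    change 0 ≤ pairing _ ((r : ℝ) • a)
    rw [map_smul]
    exact mul_nonneg r.2 ha

/-- The localization statement: for the face `τ = σ ∩ m^⊥`, the ring `ℂ[S_τ]` is `ℂ[S_σ]` with
`χ^m` inverted. -/
lemma isLocalization_face {σ τ : PointedCone ℝ (RealSpace N)} (hσ : IsRational σ)
    {m : DualLattice N} (hm : m ∈ semigroup σ)
    (hτ : ∀ x, x ∈ τ ↔ x ∈ σ ∧ pairing m x = 0) (h : MapsCone LinearMap.id τ σ) :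
    letI := (AddMonoidAlgebra.mapDomainRingHom ℂ (semigroupMap LinearMap.id h)).toAlgebra
    IsLocalization.Away (AddMonoidAlgebra.single (⟨m, hm⟩ : semigroup σ) (1 : ℂ))
      (chartRing τ) := by
  let := (AddMonoidAlgebra.mapDomainRingHom ℂ (semigroupMap LinearMap.id h)).toAlgebra
  have halg : ∀ a : chartRing σ, algebraMap (chartRing σ) (chartRing τ) a =
    AddMonoidAlgebra.mapDomain (semigroupMap LinearMap.id h) a := fun _ => rfl
  have hinj : Function.Injective (semigroupMap LinearMap.id h) := by
    intro a b hab
    exact Subtype.ext (congrArg (fun t : semigroup τ => t.1) hab)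
  have hmτ : m ∈ semigroup τ := fun x hx => (((hτ x).mp hx).2).ge
  have hnτ : -m ∈ semigroup τ := fun x hx => by
    have := ((hτ x).mp hx).2
    have e : pairing (-m) x = -pairing m x := by
      have := pairing_add m (-m) x
      rw [add_neg_cancel, pairing_zero] at this
      linarith
    rw [e, this]; simp
  have hunit : IsUnit (algebraMap (chartRing σ) (chartRing τ)
      (AddMonoidAlgebra.single (⟨m, hm⟩ : semigroup σ) (1 : ℂ))) := by
    refine IsUnit.of_mul_eq_one
      (AddMonoidAlgebra.single (⟨-m, hnτ⟩ : semigroup τ) (1 : ℂ)) ?_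
    rw [halg, AddMonoidAlgebra.mapDomain_single, AddMonoidAlgebra.single_mul_single,
      AddMonoidAlgebra.one_def, one_mul]
    congr 1
    exact Subtype.ext (add_neg_cancel m)
  have hsurj : ∀ z : chartRing τ, ∃ (k : ℕ) (a : chartRing σ),
      z * algebraMap (chartRing σ) (chartRing τ)
        (AddMonoidAlgebra.single (⟨m, hm⟩ : semigroup σ) (1 : ℂ)) ^ k =
      algebraMap (chartRing σ) (chartRing τ) a := by
    intro z
    induction z using AddMonoidAlgebra.induction_linear with
    | zero => exact ⟨0, 0, by simp⟩
    | add f g hf hg =>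
      obtain ⟨k, a, ha⟩ := hf
      obtain ⟨l, b, hb⟩ := hg
      refine ⟨k + l, a * AddMonoidAlgebra.single (⟨m, hm⟩ : semigroup σ) (1 : ℂ) ^ l +
        b * AddMonoidAlgebra.single (⟨m, hm⟩ : semigroup σ) (1 : ℂ) ^ k, ?_⟩
      rw [map_add, map_mul, map_mul, ← ha, ← hb, map_pow, map_pow]
      ring
    | single m' r =>
      obtain ⟨k, hk⟩ := exists_add_nsmul_mem hσ hm hτ m'.1 m'.2
      refine ⟨k, AddMonoidAlgebra.single ⟨_, hk⟩ r, ?_⟩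
      rw [halg, halg, AddMonoidAlgebra.mapDomain_single, AddMonoidAlgebra.mapDomain_single,
        AddMonoidAlgebra.single_pow, AddMonoidAlgebra.single_mul_single, one_pow, mul_one]
      congr 1
  refine ⟨?_, ?_, ?_⟩
  · rintro ⟨_, k, rfl⟩
    rw [map_pow]
    exact hunit.pow k
  · intro z
    obtain ⟨k, a, ha⟩ := hsurj z
    refine ⟨(a, ⟨_, k, rfl⟩), ?_⟩
    dsimp only
    rw [map_pow]
    exact ha
  · intro x y hxy
    exact ⟨1, by rw [AddMonoidAlgebra.mapDomain_injective hinj hxy]⟩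

lemma isOpenImmersion_chartMap {σ τ : PointedCone ℝ (RealSpace N)} (hσ : IsRational σ)
    (hτ : IsFace τ σ) (h : MapsCone LinearMap.id τ σ) :
    IsOpenImmersion (chartMap LinearMap.id h) := by
  obtain ⟨m, hm, hτ⟩ := hτ
  let := (AddMonoidAlgebra.mapDomainRingHom ℂ (semigroupMap LinearMap.id h)).toAlgebra
  have := isLocalization_face hσ hm hτ h
  exact IsOpenImmersion.of_isLocalization
    (AddMonoidAlgebra.single (⟨m, hm⟩ : semigroup σ) (1 : ℂ))

lemma range_chartMap {σ τ : PointedCone ℝ (RealSpace N)} (hσ : IsRational σ)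
    {m : DualLattice N} (hm : m ∈ semigroup σ)
    (hτ : ∀ x, x ∈ τ ↔ x ∈ σ ∧ pairing m x = 0) (h : MapsCone LinearMap.id τ σ) :
    Set.range (chartMap LinearMap.id h) =
      (PrimeSpectrum.basicOpen (AddMonoidAlgebra.single (⟨m, hm⟩ : semigroup σ) (1 : ℂ)) :
        Set (PrimeSpectrum (chartRing σ))) := by
  let := (AddMonoidAlgebra.mapDomainRingHom ℂ (semigroupMap LinearMap.id h)).toAlgebra
  have := isLocalization_face hσ hm hτ h
  exact PrimeSpectrum.localization_away_comap_range (chartRing τ)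
    (AddMonoidAlgebra.single (⟨m, hm⟩ : semigroup σ) (1 : ℂ))

/-! ### The toric variety of a fan -/

namespace Fan

variable (F : Fan N) (F' : Fan N')

/-- The diagram `σ ↦ U_σ` of affine charts, indexed by the cones of the fan ordered by
inclusion. -/
def diagram : F.cones ⥤ Scheme.{0} where
  obj σ := chart σ.1
  map {σ τ} f := chartMap LinearMap.id (MapsCone.of_le (show σ.1 ≤ τ.1 from leOfHom f))
  map_id _ := chartMap_id _
  map_comp _ _ :=
    (chartMap_id_comp _ _ _).symm

instance {σ τ : F.cones} (f : σ ⟶ τ) : IsOpenImmersion (F.diagram.map f) :=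
  isOpenImmersion_chartMap (F.rational _ τ.2) (F.isFace_of_le τ.2 σ.2 (leOfHom f)) _

instance : (F.diagram ⋙ Scheme.forget).IsLocallyDirected where
  cond := by
    intro σ₁ σ₂ ρ f₁ f₂ x₁ x₂ hx
    let l : F.cones := ⟨σ₁.1 ⊓ σ₂.1, F.inf_mem σ₁.2 σ₂.2⟩
    let g₁ : l ⟶ σ₁ := homOfLE (show σ₁.1 ⊓ σ₂.1 ≤ σ₁.1 from inf_le_left)
    let g₂ : l ⟶ σ₂ := homOfLE (show σ₁.1 ⊓ σ₂.1 ≤ σ₂.1 from inf_le_right)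
    change F.diagram.map f₁ x₁ = F.diagram.map f₂ x₂ at hx
    obtain ⟨m, hm, h2⟩ := F.isFace_of_le ρ.2 σ₂.2 (leOfHom f₂)
    have hm1 : m ∈ semigroup σ₁.1 := fun x hx => hm x (leOfHom f₁ hx)
    have hl : ∀ x, x ∈ l.1 ↔ x ∈ σ₁.1 ∧ pairing m x = 0 := by
      intro x
      change x ∈ σ₁.1 ⊓ σ₂.1 ↔ _
      rw [Submodule.mem_inf, h2]
      exact ⟨fun h => ⟨h.1, h.2.2⟩, fun h => ⟨h.1, leOfHom f₁ h.1, h.2⟩⟩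
    have r1 := range_chartMap (F.rational _ σ₁.2) hm1 hl (MapsCone.of_le (leOfHom g₁))
    have r2 := range_chartMap (F.rational _ ρ.2) hm h2 (MapsCone.of_le (leOfHom f₂))
    have hx1 : x₁ ∈ Set.range (F.diagram.map g₁) := by
      have : F.diagram.map f₂ x₂ ∈ Set.range (F.diagram.map f₂) := ⟨x₂, rfl⟩
      rw [← hx] at this
      have this := r2.subset this
      refine r1.symm.subset ?_
      intro hmem
      apply this
      change AddMonoidAlgebra.mapDomainRingHom ℂ
        (semigroupMap LinearMap.id (MapsCone.of_le (leOfHom f₁)))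
        (AddMonoidAlgebra.single (⟨m, hm⟩ : semigroup ρ.1) (1 : ℂ)) ∈ PrimeSpectrum.asIdeal x₁
      have e : AddMonoidAlgebra.mapDomainRingHom ℂ
        (semigroupMap LinearMap.id (MapsCone.of_le (leOfHom f₁)))
        (AddMonoidAlgebra.single (⟨m, hm⟩ : semigroup ρ.1) (1 : ℂ)) =
          AddMonoidAlgebra.single (⟨m, hm1⟩ : semigroup σ₁.1) (1 : ℂ) :=
        AddMonoidAlgebra.mapDomain_single
      rw [e]
      exact hmem
    obtain ⟨x, hx1⟩ := hx1
    refine ⟨l, g₁, g₂, x, hx1, ?_⟩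
    apply (F.diagram.map f₂).isOpenEmbedding.injective
    change F.diagram.map f₂ (F.diagram.map g₂ x) = _
    rw [← hx, ← hx1, ← Scheme.Hom.comp_apply, ← Scheme.Hom.comp_apply, ← Functor.map_comp,
      ← Functor.map_comp]
    rfl

/-- The toric variety `X_Σ` of a fan: the charts `U_σ`, `σ ∈ Σ`, glued along the open subschemes
`U_τ ⊆ U_σ` for the faces `τ` of `σ`. -/
def toricVariety : Scheme.{0} := colimit F.diagram

/-- The inclusion of the chart `U_σ` in `X_Σ`. -/
def chartIncl (σ : F.cones) : chart σ.1 ⟶ F.toricVariety := colimit.ι F.diagram σ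

lemma chartMap_chartIncl {σ τ : F.cones} (h : MapsCone LinearMap.id σ.1 τ.1) (h' : σ.1 ≤ τ.1) :
    chartMap LinearMap.id h ≫ F.chartIncl τ = F.chartIncl σ :=
  colimit.w F.diagram (homOfLE (show σ ≤ τ from h'))

/-- Morphisms out of `X_Σ` are glued from compatible morphisms on the charts. -/
def glue {Y : Scheme.{0}} (g : ∀ σ : F.cones, chart σ.1 ⟶ Y)
    (hg : ∀ (σ τ : F.cones) (h : σ.1 ≤ τ.1),
      chartMap LinearMap.id (MapsCone.of_le h) ≫ g τ = g σ) : F.toricVariety ⟶ Y :=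
  colimit.desc F.diagram
    { pt := Y
      ι :=
        { app := g
          naturality := fun σ τ f => (hg σ τ (leOfHom f)).trans (Category.comp_id (g σ)).symm } }

lemma chartIncl_glue {Y : Scheme.{0}} (g : ∀ σ : F.cones, chart σ.1 ⟶ Y) (hg) (σ : F.cones) :
    F.chartIncl σ ≫ F.glue g hg = g σ :=
  colimit.ι_desc _ _

lemma hom_ext {Y : Scheme.{0}} {f g : F.toricVariety ⟶ Y}
    (h : ∀ σ, F.chartIncl σ ≫ f = F.chartIncl σ ≫ g) : f = g :=
  colimit.hom_ext h

/-- The structure morphism `X_Σ → Spec ℂ`. -/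
def structureMap : F.toricVariety ⟶ Spec (CommRingCat.of ℂ) :=
  F.glue (fun σ => Spec.map (CommRingCat.ofHom (algebraMap ℂ (chartRing σ.1)))) (by
    intro σ τ h
    rw [chartMap, ← Spec.map_comp, ← CommRingCat.ofHom_comp]
    congr 2
    ext r
    simp)

end Fan

/-! ### Toric morphisms -/

/-- `φ : N → N'` is a map of fans: every cone of `F` is mapped into some cone of `F'`. -/
def IsFanMap (φ : N →ₗ[ℤ] N') (F : Fan N) (F' : Fan N') : Prop :=
  ∀ σ ∈ F.cones, ∃ σ' ∈ F'.cones, MapsCone φ σ σ'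

lemma chartMap_chartIncl_eq (φ : N →ₗ[ℤ] N') (F' : Fan N') {σ : PointedCone ℝ (RealSpace N)}
    {σ₁ σ₂ : F'.cones} (h₁ : MapsCone φ σ σ₁.1) (h₂ : MapsCone φ σ σ₂.1) :
    chartMap φ h₁ ≫ F'.chartIncl σ₁ = chartMap φ h₂ ≫ F'.chartIncl σ₂ := by
  let l : F'.cones := ⟨σ₁.1 ⊓ σ₂.1, F'.inf_mem σ₁.2 σ₂.2⟩
  have hl : MapsCone φ σ l.1 := fun x hx => ⟨h₁ x hx, h₂ x hx⟩
  have e₁ : chartMap φ h₁ = chartMap φ hl ≫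
      chartMap LinearMap.id (MapsCone.of_le (show l.1 ≤ σ₁.1 from inf_le_left)) :=
    (chartMap_comp_id _ _ _).symm
  have e₂ : chartMap φ h₂ = chartMap φ hl ≫
      chartMap LinearMap.id (MapsCone.of_le (show l.1 ≤ σ₂.1 from inf_le_right)) :=
    (chartMap_comp_id _ _ _).symm
  rw [e₁, e₂, Category.assoc, Category.assoc, F'.chartMap_chartIncl _ inf_le_left,
    F'.chartMap_chartIncl _ inf_le_right]

/-- The toric morphism `X_F → X_F'` induced by a map of fans `φ`: on a chart `U_σ` it is
`U_σ → U_σ' ⊆ X_F'`, `χ^m ↦ χ^(m ∘ φ)`, for any cone `σ'` containing `φ_ℝ(σ)`. -/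
def toricMap (φ : N →ₗ[ℤ] N') {F : Fan N} {F' : Fan N'} (h : IsFanMap φ F F') :
    F.toricVariety ⟶ F'.toricVariety :=
  F.glue (fun σ => chartMap φ (h σ.1 σ.2).choose_spec.2 ≫
      F'.chartIncl ⟨(h σ.1 σ.2).choose, (h σ.1 σ.2).choose_spec.1⟩) (by
    intro σ τ hστ
    have h' : MapsCone φ σ.1 (h τ.1 τ.2).choose :=
      fun x hx => (h τ.1 τ.2).choose_spec.2 x (hστ hx)
    rw [← Category.assoc, chartMap_id_comp _ _ h']
    exact chartMap_chartIncl_eq φ F' (σ₁ := ⟨_, _⟩) (σ₂ := ⟨_, _⟩) h' (h σ.1 σ.2).choose_spec.2)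

/-- The torus `T_N = Spec ℂ[M]`. -/
abbrev torus (N : Type) [AddCommGroup N] : Scheme.{0} :=
  Spec (CommRingCat.of (AddMonoidAlgebra ℂ (DualLattice N)))

/-- The homomorphism of tori `T_N → T_N'` induced by `φ : N → N'`, i.e. by
`χ^m ↦ χ^(m ∘ φ)`. -/
def torusMap (φ : N →ₗ[ℤ] N') : torus N ⟶ torus N' :=
  Spec.map (CommRingCat.ofHom
    (AddMonoidAlgebra.mapDomainRingHom ℂ φ.dualMap.toAddMonoidHom))

/-- The inclusion of the torus `T_N = U_{0}` in `X_F`, as the chart of the zero cone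
(for which `S_{0} = M`). -/
def torusIncl (F : Fan N) : torus N ⟶ F.toricVariety :=
  Spec.map (CommRingCat.ofHom (AddMonoidAlgebra.mapDomainRingHom ℂ
    (semigroup (⊥ : PointedCone ℝ (RealSpace N))).subtype)) ≫ F.chartIncl ⟨⊥, F.bot_mem⟩

/-- The group `T_N(ℂ) = Hom(M, ℂˣ)` of complex points of the torus. -/
abbrev TorusPoint (N : Type) [AddCommGroup N] : Type :=
  Multiplicative (DualLattice N) →* ℂˣ

/-- The homomorphism `T_N(ℂ) → T_N'(ℂ)` induced by `φ : N → N'`. -/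
def TorusPoint.map (φ : N →ₗ[ℤ] N') (t : TorusPoint N) : TorusPoint N' :=
  t.comp (AddMonoidHom.toMultiplicative φ.dualMap.toAddMonoidHom)

/-- The action of `t ∈ T_N(ℂ)` on the chart `U_σ`: `χ^m ↦ t(m) χ^m`. -/
def chartAct (t : TorusPoint N) (σ : PointedCone ℝ (RealSpace N)) : chart σ ⟶ chart σ :=
  Spec.map (CommRingCat.ofHom (AddMonoidAlgebra.lift ℂ (chartRing σ) (semigroup σ)
    { toFun := fun m => AddMonoidAlgebra.single m.toAdd
        ((t (Multiplicative.ofAdd (m.toAdd : DualLattice N)) : ℂˣ) : ℂ)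
      map_one' := by
        simp [AddMonoidAlgebra.one_def]
      map_mul' := fun a b => by
        simp [AddMonoidAlgebra.single_mul_single] }).toRingHom)

lemma chartMap_chartAct (t : TorusPoint N) (φ : N →ₗ[ℤ] N') {σ : PointedCone ℝ (RealSpace N)}
    {σ' : PointedCone ℝ (RealSpace N')} (h : MapsCone φ σ σ') :
    chartMap φ h ≫ chartAct (t.map φ) σ' = chartAct t σ ≫ chartMap φ h := by
  rw [chartMap, chartAct, chartAct, ← Spec.map_comp, ← Spec.map_comp, ← CommRingCat.ofHom_comp,
    ← CommRingCat.ofHom_comp]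
  congr 2
  ext m
  · simp
  · simp [TorusPoint.map, semigroupMap]
    rfl

/-- The action of `t ∈ T_N(ℂ)` on the toric variety `X_F`. -/
def torusAct (F : Fan N) (t : TorusPoint N) : F.toricVariety ⟶ F.toricVariety :=
  F.glue (fun σ => chartAct t σ.1 ≫ F.chartIncl σ) (by
    intro σ τ h
    have := chartMap_chartAct t LinearMap.id (MapsCone.of_le h)
    rw [← Category.assoc]
    change (_ ≫ chartAct (t.map LinearMap.id) τ.1) ≫ _ = _
    rw [this, Category.assoc, F.chartMap_chartIncl _ h])

/-! ### Fibre bundles and preimages of charts -/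

lemma isPullback_of_openCover {W U X S : Scheme.{0}} {a : W ⟶ U} {q : W ⟶ X} {s : U ⟶ S}
    {t : X ⟶ S} (w : a ≫ s = q ≫ t) (𝒰 : X.OpenCover) (V : 𝒰.I₀ → Scheme.{0})
    (v : ∀ i, V i ⟶ W) (r : ∀ i, V i ⟶ 𝒰.X i) (h₁ : ∀ i, IsPullback (v i) (r i) q (𝒰.f i))
    (h₂ : ∀ i, IsPullback (v i ≫ a) (r i) s (𝒰.f i ≫ t)) : IsPullback a q s t := by
  have hP : IsPullback (pullback.fst s t) (pullback.snd s t) s t := IsPullback.of_hasPullback _ _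
  obtain ⟨l, hl1, hl2⟩ : ∃ l : W ⟶ pullback s t, l ≫ pullback.fst s t = a ∧
      l ≫ pullback.snd s t = q := ⟨hP.lift a q w, hP.lift_fst _ _ _, hP.lift_snd _ _ _⟩
  have hl : IsIso l := by
    change MorphismProperty.isomorphisms Scheme l
    refine IsZariskiLocalAtTarget.of_openCover (𝒰.pullback₁ (pullback.snd s t)) fun i => ?_
    have hR : IsPullback (pullback.fst (pullback.snd s t) (𝒰.f i))
      (pullback.snd (pullback.snd s t) (𝒰.f i)) (pullback.snd s t) (𝒰.f i) :=
      IsPullback.of_hasPullback _ _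
    have hc : (v i ≫ l) ≫ pullback.snd s t = r i ≫ 𝒰.f i := by
      rw [Category.assoc, hl2, (h₁ i).w]
    obtain ⟨b, hb1, hb2⟩ : ∃ b : V i ⟶ pullback (pullback.snd s t) (𝒰.f i),
        b ≫ pullback.fst (pullback.snd s t) (𝒰.f i) = v i ≫ l ∧
        b ≫ pullback.snd (pullback.snd s t) (𝒰.f i) = r i :=
      ⟨hR.lift _ _ hc, hR.lift_fst _ _ _, hR.lift_snd _ _ _⟩
    have hL : IsPullback (v i) b l (pullback.fst (pullback.snd s t) (𝒰.f i)) := by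
      refine IsPullback.of_bot ?_ hb1.symm hR
      rw [hb2, hl2]
      exact h₁ i
    have K := hR.paste_horiz hP
    have hb : IsIso b := by
      have e : b = ((h₂ i).isoIsPullback _ _ K).hom := by
        apply K.hom_ext
        · rw [IsPullback.isoIsPullback_hom_fst, ← Category.assoc, hb1, Category.assoc, hl1]
        · rw [IsPullback.isoIsPullback_hom_snd, hb2]
      rw [e]
      infer_instance
    have e : pullback.snd l (pullback.fst (pullback.snd s t) (𝒰.f i)) =
        hL.isoPullback.inv ≫ b := by
      rw [IsPullback.isoPullback_inv_snd]
    change IsIso (pullback.snd l (pullback.fst (pullback.snd s t) (𝒰.f i)))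
    rw [e]
    infer_instance
  exact IsPullback.of_iso_pullback ⟨w⟩ (asIso l) hl1 hl2

lemma Fan.exists_chartIncl (F : Fan N) (x : F.toricVariety) :
    ∃ (σ : F.cones) (y : chart σ.1), F.chartIncl σ y = x := by
  obtain ⟨σ, y, h⟩ := (Scheme.IsLocallyDirected.openCover F.diagram).exists_eq x
  exact ⟨σ, y, h⟩

instance (F : Fan N) (σ : F.cones) : IsOpenImmersion (F.chartIncl σ) :=
  inferInstanceAs (IsOpenImmersion (colimit.ι F.diagram σ))

lemma Fan.chartIncl_eq_iff (F : Fan N) {σ τ : F.cones} {x : chart σ.1} {y : chart τ.1}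
    (h : F.chartIncl σ x = F.chartIncl τ y) : ∃ (ρ : F.cones) (h₁ : ρ.1 ≤ σ.1) (h₂ : ρ.1 ≤ τ.1)
      (z : chart ρ.1), chartMap LinearMap.id (MapsCone.of_le h₁) z = x ∧
        chartMap LinearMap.id (MapsCone.of_le h₂) z = y := by
  obtain ⟨ρ, f, g, z, h1, h2⟩ := (Scheme.IsLocallyDirected.ι_eq_ι_iff F.diagram).mp h
  exact ⟨ρ, leOfHom f, leOfHom g, z, h1, h2⟩

lemma chartIncl_toricMap (φ : N →ₗ[ℤ] N') {F : Fan N} {F' : Fan N'} (h : IsFanMap φ F F')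
    (σ : F.cones) (σ' : F'.cones) (hσ : MapsCone φ σ.1 σ'.1) :
    F.chartIncl σ ≫ toricMap φ h = chartMap φ hσ ≫ F'.chartIncl σ' := by
  rw [toricMap, Fan.chartIncl_glue]
  exact chartMap_chartIncl_eq φ F' (σ₁ := ⟨_, _⟩) _ _

/-- The preimage under `U_σ → U_σ'` of the chart of a face of `σ'` is the chart of a face. -/
lemma exists_face_of_chartMap_mem (φ : N →ₗ[ℤ] N') {F : Fan N} {F' : Fan N'} (σ : F.cones)
    (σ' ρ' : F'.cones) (hσ : MapsCone φ σ.1 σ'.1) (hρ : ρ'.1 ≤ σ'.1) (y : chart σ.1)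
    (w : chart ρ'.1) (hy : chartMap LinearMap.id (MapsCone.of_le hρ) w = chartMap φ hσ y) :
    ∃ (ρ : F.cones) (h : ρ.1 ≤ σ.1) (z : chart ρ.1), MapsCone φ ρ.1 ρ'.1 ∧
      chartMap LinearMap.id (MapsCone.of_le h) z = y := by
  obtain ⟨m, hm, hρ'⟩ := F'.isFace_of_le σ'.2 ρ'.2 hρ
  have hm1 : m ∘ₗ φ ∈ semigroup σ.1 := fun x hx => by
    rw [← pairing_baseChange]; exact hm _ (hσ x hx)
  have hf := isFace_cut hm1
  let ρ : F.cones := ⟨_, F.face_mem _ σ.2 _ hf⟩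
  have hρσ : ρ.1 ≤ σ.1 := inf_le_left
  have r1 := range_chartMap (τ := ρ.1) (F.rational _ σ.2) hm1 (fun _ => Iff.rfl)
    (MapsCone.of_le hρσ)
  have r2 := range_chartMap (F'.rational _ σ'.2) hm hρ' (MapsCone.of_le hρ)
  have hy1 : y ∈ Set.range (chartMap LinearMap.id (MapsCone.of_le hρσ)) := by
    have := r2.subset ⟨w, hy⟩
    refine r1.symm.subset ?_
    intro hmem
    apply this
    change AddMonoidAlgebra.mapDomainRingHom ℂ (semigroupMap φ hσ)
      (AddMonoidAlgebra.single (⟨m, hm⟩ : semigroup σ'.1) (1 : ℂ)) ∈ PrimeSpectrum.asIdeal y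
    have e : AddMonoidAlgebra.mapDomainRingHom ℂ (semigroupMap φ hσ)
      (AddMonoidAlgebra.single (⟨m, hm⟩ : semigroup σ'.1) (1 : ℂ)) =
        AddMonoidAlgebra.single (⟨m ∘ₗ φ, hm1⟩ : semigroup σ.1) (1 : ℂ) :=
      AddMonoidAlgebra.mapDomain_single
    rw [e]
    exact hmem
  obtain ⟨z, hz⟩ := hy1
  refine ⟨ρ, hρσ, z, fun x hx => ?_, hz⟩
  rw [hρ', pairing_baseChange]
  exact ⟨hσ _ hx.1, hx.2⟩

/-- A point of `X_F` that `toricMap φ` maps into the chart of `τ` lies in the chart of a cone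
that `φ` maps into `τ`. -/
lemma exists_chart_of_toricMap_mem (φ : N →ₗ[ℤ] N') {F : Fan N} {F' : Fan N'}
    (h : IsFanMap φ F F') (τ : F'.cones) (x : F.toricVariety)
    (hx : toricMap φ h x ∈ Set.range (F'.chartIncl τ)) :
    ∃ (ρ : F.cones) (z : chart ρ.1), MapsCone φ ρ.1 τ.1 ∧ F.chartIncl ρ z = x := by
  obtain ⟨u, hu⟩ := hx
  obtain ⟨σ, y, rfl⟩ := F.exists_chartIncl x
  obtain ⟨σ', hσ', hσσ'⟩ := h σ.1 σ.2
  rw [← Scheme.Hom.comp_apply, chartIncl_toricMap φ h σ ⟨σ', hσ'⟩ hσσ', Scheme.Hom.comp_apply] at hu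
  obtain ⟨ρ', h1, h2, w, hw1, hw2⟩ := F'.chartIncl_eq_iff hu
  obtain ⟨ρ, hρ, z, hz1, hz2⟩ := exists_face_of_chartMap_mem φ σ ⟨σ', hσ'⟩ ρ' hσσ' h2 y w hw2
  refine ⟨ρ, z, fun x hx => h1 (hz1 x hx), ?_⟩
  rw [← hz2, ← Scheme.Hom.comp_apply, F.chartMap_chartIncl _ hρ]


section MonoidAlgebra

variable {S T C : Type} [AddCommMonoid S] [AddCommMonoid T] [AddCommMonoid C]

lemma monoidAlgebra_exists_desc (f : S →+ C) (g : T →+ C) (p : C →+ S) (r : C →+ T)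
    (hpf : ∀ s, p (f s) = s) (hpg : ∀ t, p (g t) = 0) (hrf : ∀ s, r (f s) = 0)
    (hrg : ∀ t, r (g t) = t) {R : Type} [CommRing R] (u : AddMonoidAlgebra ℂ S →+* R)
    (v : AddMonoidAlgebra ℂ T →+* R)
    (huv : u.comp (algebraMap ℂ (AddMonoidAlgebra ℂ S)) =
      v.comp (algebraMap ℂ (AddMonoidAlgebra ℂ T))) :
    ∃ h : AddMonoidAlgebra ℂ C →+* R, h.comp (AddMonoidAlgebra.mapDomainRingHom ℂ f) = u ∧
      h.comp (AddMonoidAlgebra.mapDomainRingHom ℂ g) = v := by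
  have e1 : ∀ x y : S, (AddMonoidAlgebra.single (x + y) 1 : AddMonoidAlgebra ℂ S) =
    AddMonoidAlgebra.single x 1 * AddMonoidAlgebra.single y 1 := by simp
  have e2 : ∀ x y : T, (AddMonoidAlgebra.single (x + y) 1 : AddMonoidAlgebra ℂ T) =
    AddMonoidAlgebra.single x 1 * AddMonoidAlgebra.single y 1 := by simp
  let φ : Multiplicative C →* R :=
    { toFun := fun c => u (AddMonoidAlgebra.single (p c.toAdd) 1) *
          v (AddMonoidAlgebra.single (r c.toAdd) 1)
      map_one' := by simp [← AddMonoidAlgebra.one_def]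
      map_mul' := fun a b => by
        rw [toAdd_mul, map_add, map_add, e1, e2, map_mul, map_mul]
        ring }
  have huv' : ∀ z : ℂ, u (AddMonoidAlgebra.single 0 z) = v (AddMonoidAlgebra.single 0 z) :=
    fun z => by simpa using congrArg (fun h => h z) huv
  let h : AddMonoidAlgebra ℂ C →+* R := AddMonoidAlgebra.liftNCRingHom
    (u.comp (algebraMap ℂ (AddMonoidAlgebra ℂ S))) φ (fun _ _ => Commute.all _ _)
  have hs : ∀ (c : C) (z : ℂ), h (AddMonoidAlgebra.single c z) =
      u (AddMonoidAlgebra.single 0 z) * (u (AddMonoidAlgebra.single (p c) 1) *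
        v (AddMonoidAlgebra.single (r c) 1)) := by
    intro c z
    exact (AddMonoidAlgebra.liftNC_single _ _ _ _)
  refine ⟨h, ?_, ?_⟩
  · refine AddMonoidAlgebra.ringHom_ext (fun z => ?_) (fun x => ?_)
    · simp [hs, ← AddMonoidAlgebra.one_def]
    · simp [hs, hpf, hrf, ← AddMonoidAlgebra.one_def]
  · refine AddMonoidAlgebra.ringHom_ext (fun z => ?_) (fun x => ?_)
    · simp [hs, huv', ← AddMonoidAlgebra.one_def]
    · simp [hs, hpg, hrg, ← AddMonoidAlgebra.one_def]

lemma monoidAlgebra_hom_ext (f : S →+ C) (g : T →+ C) (p : C →+ S) (r : C →+ T)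
    (hc : ∀ c, f (p c) + g (r c) = c) {R : Type} [CommRing R]
    {h h' : AddMonoidAlgebra ℂ C →+* R}
    (hf : h.comp (AddMonoidAlgebra.mapDomainRingHom ℂ f) =
      h'.comp (AddMonoidAlgebra.mapDomainRingHom ℂ f))
    (hg : h.comp (AddMonoidAlgebra.mapDomainRingHom ℂ g) =
      h'.comp (AddMonoidAlgebra.mapDomainRingHom ℂ g)) : h = h' := by
  have hf' : ∀ (s : S) (z : ℂ), h (AddMonoidAlgebra.single (f s) z) =
      h' (AddMonoidAlgebra.single (f s) z) := fun s z => by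
    simpa using congrArg (fun k => k (AddMonoidAlgebra.single s z)) hf
  have hg' : ∀ (t : T) (z : ℂ), h (AddMonoidAlgebra.single (g t) z) =
      h' (AddMonoidAlgebra.single (g t) z) := fun t z => by
    simpa using congrArg (fun k => k (AddMonoidAlgebra.single t z)) hg
  have e : ∀ (c : C) (z : ℂ), (AddMonoidAlgebra.single c z : AddMonoidAlgebra ℂ C) =
      AddMonoidAlgebra.single (f (p c)) z * AddMonoidAlgebra.single (g (r c)) 1 := by
    intro c z
    rw [AddMonoidAlgebra.single_mul_single, hc, mul_one]
  refine AddMonoidAlgebra.ringHom_ext (fun z => ?_) (fun x => ?_)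
  · rw [e, map_mul, map_mul, hf', hg']
  · rw [e, map_mul, map_mul, hf', hg']

/-- The monoid algebra of a direct sum of monoids is the tensor product. -/
lemma isPushout_monoidAlgebra (f : S →+ C) (g : T →+ C) (p : C →+ S) (r : C →+ T)
    (hpf : ∀ s, p (f s) = s) (hpg : ∀ t, p (g t) = 0) (hrf : ∀ s, r (f s) = 0)
    (hrg : ∀ t, r (g t) = t) (hc : ∀ c, f (p c) + g (r c) = c) :
    IsPushout (CommRingCat.ofHom (algebraMap ℂ (AddMonoidAlgebra ℂ S)))
      (CommRingCat.ofHom (algebraMap ℂ (AddMonoidAlgebra ℂ T)))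
      (CommRingCat.ofHom (AddMonoidAlgebra.mapDomainRingHom ℂ f))
      (CommRingCat.ofHom (AddMonoidAlgebra.mapDomainRingHom ℂ g)) := by
  have hw : CommRingCat.ofHom (algebraMap ℂ (AddMonoidAlgebra ℂ S)) ≫
      CommRingCat.ofHom (AddMonoidAlgebra.mapDomainRingHom ℂ f) =
      CommRingCat.ofHom (algebraMap ℂ (AddMonoidAlgebra ℂ T)) ≫
      CommRingCat.ofHom (AddMonoidAlgebra.mapDomainRingHom ℂ g) := by
    ext r
    simp
  have H : ∀ s : PushoutCocone (CommRingCat.ofHom (algebraMap ℂ (AddMonoidAlgebra ℂ S)))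
      (CommRingCat.ofHom (algebraMap ℂ (AddMonoidAlgebra ℂ T))),
      ∃ h : AddMonoidAlgebra ℂ C →+* s.pt,
        h.comp (AddMonoidAlgebra.mapDomainRingHom ℂ f) = s.inl.hom ∧
        h.comp (AddMonoidAlgebra.mapDomainRingHom ℂ g) = s.inr.hom := fun s =>
    monoidAlgebra_exists_desc f g p r hpf hpg hrf hrg s.inl.hom s.inr.hom
      (congrArg CommRingCat.Hom.hom s.condition)
  choose d hd1 hd2 using H
  refine ⟨⟨hw⟩, ⟨PushoutCocone.IsColimit.mk hw (fun s => CommRingCat.ofHom (d s))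
    (fun s => CommRingCat.hom_ext (hd1 s)) (fun s => CommRingCat.hom_ext (hd2 s)) ?_⟩⟩
  intro s m h1 h2
  refine CommRingCat.hom_ext (monoidAlgebra_hom_ext f g p r hc ?_ ?_)
  · exact (congrArg CommRingCat.Hom.hom h1).trans (hd1 s).symm
  · exact (congrArg CommRingCat.Hom.hom h2).trans (hd2 s).symm

end MonoidAlgebra

/-- `p : E → B` is a (Zariski) locally trivial fibre bundle of `ℂ`-schemes with fibre `X`:
every point of `B` has an open neighbourhood `U` with an isomorphism `p⁻¹(U) ≅ U × X` over `U`. -/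
def IsFibreBundle {E B X : Scheme.{0}} (p : E ⟶ B) (sB : B ⟶ Spec (CommRingCat.of ℂ))
    (sX : X ⟶ Spec (CommRingCat.of ℂ)) : Prop :=
  ∀ b : B, ∃ U : B.Opens, b ∈ U ∧
    ∃ e : (p ⁻¹ᵁ U).toScheme ≅ pullback (U.ι ≫ sB) sX,
      e.hom ≫ pullback.fst (U.ι ≫ sB) sX = p ∣_ U

lemma IsFibreBundle.of_isPullback {E B X : Scheme.{0}} {p : E ⟶ B}
    {sB : B ⟶ Spec (CommRingCat.of ℂ)} {sX : X ⟶ Spec (CommRingCat.of ℂ)}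
    (H : ∀ b : B, ∃ (V W : Scheme.{0}) (j : V ⟶ B) (k : W ⟶ E) (a : W ⟶ V) (q : W ⟶ X),
      IsOpenImmersion j ∧ b ∈ Set.range j ∧ IsPullback a k j p ∧
        IsPullback a q (j ≫ sB) sX) : IsFibreBundle p sB sX := by
  intro b
  obtain ⟨V, W, j, k, a, q, hj, hb, h₁, h₂⟩ := H b
  refine ⟨j.opensRange, hb, ?_⟩
  have hi : j.isoOpensRange.hom ≫ j.opensRange.ι = j := by simp
  have h₁' : IsPullback (a ≫ j.isoOpensRange.hom) k j.opensRange.ι p := by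
    refine h₁.of_iso (Iso.refl _) j.isoOpensRange (Iso.refl _) (Iso.refl _) ?_ ?_ ?_ ?_ <;> simp
  have h₂' : IsPullback (a ≫ j.isoOpensRange.hom) q (j.opensRange.ι ≫ sB) sX := by
    refine h₂.of_iso (Iso.refl _) j.isoOpensRange (Iso.refl _) (Iso.refl _) ?_ ?_ ?_ ?_ <;> simp
  have h₃ := (isPullback_morphismRestrict p j.opensRange)
  refine ⟨(h₃.isoIsPullback _ _ h₁') ≪≫ h₂'.isoPullback, ?_⟩
  rw [Iso.trans_hom, Category.assoc, IsPullback.isoPullback_hom_fst,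
    IsPullback.isoIsPullback_hom_fst]

lemma chartMap_algebraMap (φ : N →ₗ[ℤ] N') {σ : PointedCone ℝ (RealSpace N)}
    {σ' : PointedCone ℝ (RealSpace N')} (h : MapsCone φ σ σ') :
    chartMap φ h ≫ Spec.map (CommRingCat.ofHom (algebraMap ℂ (chartRing σ'))) =
      Spec.map (CommRingCat.ofHom (algebraMap ℂ (chartRing σ))) := by
  rw [chartMap, ← Spec.map_comp, ← CommRingCat.ofHom_comp]
  congr 2
  ext r
  simp

lemma Fan.chartIncl_structureMap (F : Fan N) (σ : F.cones) :
    F.chartIncl σ ≫ F.structureMap =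
      Spec.map (CommRingCat.ofHom (algebraMap ℂ (chartRing σ.1))) :=
  F.chartIncl_glue _ _ _

lemma toricMap_structureMap (φ : N →ₗ[ℤ] N') {F : Fan N} {F' : Fan N'} (h : IsFanMap φ F F') :
    toricMap φ h ≫ F'.structureMap = F.structureMap := by
  refine F.hom_ext fun σ => ?_
  obtain ⟨σ', hσ', hh⟩ := h σ.1 σ.2
  rw [← Category.assoc, chartIncl_toricMap φ h σ ⟨σ', hσ'⟩ hh, Category.assoc,
    Fan.chartIncl_structureMap, Fan.chartIncl_structureMap, chartMap_algebraMap]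

/-- The subfan of the cones that `φ` maps into the cone `σ`. -/
def Fan.preimage (F : Fan N) (φ : N →ₗ[ℤ] N') (σ : PointedCone ℝ (RealSpace N')) : Fan N where
  cones := {C | C ∈ F.cones ∧ MapsCone φ C σ}
  finite := F.finite.subset fun _ h => h.1
  bot_mem := ⟨F.bot_mem, fun x hx => by
    rw [Submodule.mem_bot] at hx
    rw [hx, map_zero]
    exact zero_mem σ⟩
  rational := fun C h => F.rational C h.1
  salient := fun C h => F.salient C h.1
  face_mem := fun C h D hD => ⟨F.face_mem C h.1 D hD, fun x hx => by
    obtain ⟨m, _, hm⟩ := hD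
    exact h.2 x ((hm x).mp hx).1⟩
  inf_isFace := fun C h D h' => F.inf_isFace C h.1 D h'.1

lemma isFanMap_preimage (F : Fan N) (φ : N →ₗ[ℤ] N') (σ : PointedCone ℝ (RealSpace N')) :
    IsFanMap LinearMap.id (F.preimage φ σ) F :=
  fun C h => ⟨C, h.1, MapsCone.of_le le_rfl⟩

/-- The open cover of `X_F` by its charts. -/
def Fan.openCover (F : Fan N) : F.toricVariety.OpenCover :=
  Scheme.IsLocallyDirected.openCover F.diagram

lemma chartIncl_preimage (F : Fan N) (φ : N →ₗ[ℤ] N') (σ : PointedCone ℝ (RealSpace N'))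
    (C : (F.preimage φ σ).cones) :
    (F.preimage φ σ).chartIncl C ≫ toricMap LinearMap.id (isFanMap_preimage F φ σ) =
      F.chartIncl ⟨C.1, C.2.1⟩ := by
  rw [chartIncl_toricMap _ _ C ⟨C.1, C.2.1⟩ (MapsCone.of_le le_rfl), chartMap_id,
    Category.id_comp]

instance (F : Fan N) (φ : N →ₗ[ℤ] N') (σ : PointedCone ℝ (RealSpace N')) :
    IsOpenImmersion (toricMap LinearMap.id (isFanMap_preimage F φ σ)) := by
  refine IsOpenImmersion.of_openCover_source _ (F.preimage φ σ).openCover ?_ ?_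
  · intro x y hxy
    obtain ⟨C, x, rfl⟩ := (F.preimage φ σ).exists_chartIncl x
    obtain ⟨D, y, rfl⟩ := (F.preimage φ σ).exists_chartIncl y
    rw [← Scheme.Hom.comp_apply, ← Scheme.Hom.comp_apply, chartIncl_preimage,
      chartIncl_preimage] at hxy
    obtain ⟨ρ, h1, h2, z, hz1, hz2⟩ := F.chartIncl_eq_iff hxy
    let ρ' : (F.preimage φ σ).cones := ⟨ρ.1, ρ.2, fun x hx => C.2.2 x (h1 hx)⟩
    have e1 := (F.preimage φ σ).chartMap_chartIncl (σ := ρ') (τ := C) (MapsCone.of_le h1) h1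
    have e2 := (F.preimage φ σ).chartMap_chartIncl (σ := ρ') (τ := D) (MapsCone.of_le h2) h2
    rw [← hz1, ← hz2]
    exact (congrArg (fun f => f z) e1).trans (congrArg (fun f => f z) e2).symm
  · have H : ∀ C : (F.preimage φ σ).cones, IsOpenImmersion ((F.preimage φ σ).chartIncl C ≫
        toricMap LinearMap.id (isFanMap_preimage F φ σ)) := by
      intro C
      rw [chartIncl_preimage]
      infer_instance
    exact H

/-- The morphism from the subfan to the chart `U_σ`. -/
def preimageToChart (F : Fan N) (φ : N →ₗ[ℤ] N') (σ : PointedCone ℝ (RealSpace N')) :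
    (F.preimage φ σ).toricVariety ⟶ chart σ :=
  (F.preimage φ σ).glue (fun C => chartMap φ C.2.2) (fun _ _ _ => chartMap_id_comp _ _ _)

/-- The preimage of a chart `U_σ` under a toric morphism is the toric variety of the subfan of
the cones mapped into `σ`. -/
lemma isPullback_preimage {F : Fan N} {F' : Fan N'} (φ : N →ₗ[ℤ] N') (h : IsFanMap φ F F')
    (σ : F'.cones) :
    IsPullback (preimageToChart F φ σ.1) (toricMap LinearMap.id (isFanMap_preimage F φ σ.1))
      (F'.chartIncl σ) (toricMap φ h) := by
  have hc : toricMap LinearMap.id (isFanMap_preimage F φ σ.1) ≫ toricMap φ h =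
      preimageToChart F φ σ.1 ≫ F'.chartIncl σ := by
    refine Fan.hom_ext _ fun C => ?_
    rw [← Category.assoc, chartIncl_preimage, ← Category.assoc, preimageToChart,
      Fan.chartIncl_glue]
    exact chartIncl_toricMap φ h ⟨C.1, C.2.1⟩ σ C.2.2
  refine IsOpenImmersion.isPullback _ _ _ _ hc ?_
  ext x
  constructor
  · intro hx
    obtain ⟨ρ, z, hρ, rfl⟩ := exists_chart_of_toricMap_mem φ h σ x hx
    refine ⟨(F.preimage φ σ.1).chartIncl ⟨ρ.1, ρ.2, hρ⟩ z, ?_⟩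
    rw [← Scheme.Hom.comp_apply, chartIncl_preimage]
  · rintro ⟨w, rfl⟩
    refine ⟨preimageToChart F φ σ.1 w, ?_⟩
    rw [← Scheme.Hom.comp_apply, ← hc, Scheme.Hom.comp_apply]

/-- If `C` is the largest cone that is mapped into `τ`, the preimage of `U_τ` is `U_C`. -/
lemma isPullback_chart {F : Fan N} {F' : Fan N'} (φ : N →ₗ[ℤ] N') (h : IsFanMap φ F F')
    (C : F.cones) (τ : F'.cones) (hC : MapsCone φ C.1 τ.1)
    (hmax : ∀ D ∈ F.cones, MapsCone φ D τ.1 → D ≤ C.1) :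
    IsPullback (F.chartIncl C) (chartMap φ hC) (toricMap φ h) (F'.chartIncl τ) := by
  have hc := chartIncl_toricMap φ h C τ hC
  refine (IsOpenImmersion.isPullback _ _ _ _ hc ?_).flip
  ext x
  constructor
  · intro hx
    obtain ⟨ρ, z, hρ, rfl⟩ := exists_chart_of_toricMap_mem φ h τ x hx
    refine ⟨chartMap LinearMap.id (MapsCone.of_le (hmax _ ρ.2 hρ)) z, ?_⟩
    rw [← Scheme.Hom.comp_apply, F.chartMap_chartIncl _ (hmax _ ρ.2 hρ)]
  · rintro ⟨w, rfl⟩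
    refine ⟨chartMap φ hC w, ?_⟩
    rw [← Scheme.Hom.comp_apply, ← hc, Scheme.Hom.comp_apply]

/-! ### Twisted products of fans -/

section Twisted

variable {NB NF : Type} [AddCommGroup NB] [AddCommGroup NF]

variable (NB NF) in
/-- The embedding `(N_B)_ℝ → N_ℝ`, `x ↦ (x, 0)`, for `N = N_B × N_F`. -/
def inlR : RealSpace NB →ₗ[ℝ] RealSpace (NB × NF) := (LinearMap.inl ℤ NB NF).baseChange ℝ

variable (NB NF) in
/-- The embedding `(N_F)_ℝ → N_ℝ`, `y ↦ (0, y)`. -/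
def inrR : RealSpace NF →ₗ[ℝ] RealSpace (NB × NF) := (LinearMap.inr ℤ NB NF).baseChange ℝ

variable (NB NF) in
/-- The projection `N_ℝ → (N_B)_ℝ`. -/
def fstR : RealSpace (NB × NF) →ₗ[ℝ] RealSpace NB := (LinearMap.fst ℤ NB NF).baseChange ℝ

variable (NB NF) in
/-- The projection `N_ℝ → (N_F)_ℝ`. -/
def sndR : RealSpace (NB × NF) →ₗ[ℝ] RealSpace NF := (LinearMap.snd ℤ NB NF).baseChange ℝ

@[simp] lemma fstR_inlR (x : RealSpace NB) : fstR NB NF (inlR NB NF x) = x := by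
  rw [fstR, inlR, ← LinearMap.comp_apply, ← LinearMap.baseChange_comp, LinearMap.fst_comp_inl,
    LinearMap.baseChange_id, LinearMap.id_apply]

@[simp] lemma sndR_inrR (y : RealSpace NF) : sndR NB NF (inrR NB NF y) = y := by
  rw [sndR, inrR, ← LinearMap.comp_apply, ← LinearMap.baseChange_comp, LinearMap.snd_comp_inr,
    LinearMap.baseChange_id, LinearMap.id_apply]

@[simp] lemma fstR_inrR (y : RealSpace NF) : fstR NB NF (inrR NB NF y) = 0 := by
  rw [fstR, inrR, ← LinearMap.comp_apply, ← LinearMap.baseChange_comp, LinearMap.fst_comp_inr,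
    LinearMap.baseChange_zero, LinearMap.zero_apply]

@[simp] lemma sndR_inlR (x : RealSpace NB) : sndR NB NF (inlR NB NF x) = 0 := by
  rw [sndR, inlR, ← LinearMap.comp_apply, ← LinearMap.baseChange_comp, LinearMap.snd_comp_inl,
    LinearMap.baseChange_zero, LinearMap.zero_apply]

lemma inlR_fstR_add (z : RealSpace (NB × NF)) :
    inlR NB NF (fstR NB NF z) + inrR NB NF (sndR NB NF z) = z := by
  induction z using TensorProduct.induction_on with
  | zero => simp
  | tmul r v => simp [inlR, fstR, inrR, sndR, ← TensorProduct.tmul_add]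
  | add a b ha hb =>
    rw [map_add, map_add, map_add, map_add, add_add_add_comm, ha, hb]

variable (FB : Fan NB) (FF : Fan NF)

variable (NF) in
/-- A twisting map: a map `Φ : |Σ_B| → (N_F)_ℝ` whose restriction to every cone of `Σ_B` is
linear and integral, i.e. agrees with a homomorphism of lattices `N_B → N_F`.
(Being linear on each of finitely many closed cones, `Φ` is automatically continuous.) -/
structure TwistingMap where
  toFun : FB.support → RealSpace NF
  conewise_linear : ∀ σ ∈ FB.cones, ∃ L : NB →ₗ[ℤ] NF,
    ∀ x : FB.support, x.1 ∈ σ → toFun x = L.baseChange ℝ x.1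

variable {FB} (Φ : TwistingMap NF FB)

/-- The graph `{(x, Φ(x)) | x ∈ σ}` of `Φ` over a cone `σ` of `Σ_B`. -/
def graphCone (σ : FB.cones) : PointedCone ℝ (RealSpace (NB × NF)) where
  carrier := {z | ∃ x : FB.support, x.1 ∈ σ.1 ∧ z = inlR NB NF x.1 + inrR NB NF (Φ.toFun x)}
  zero_mem' := by
    obtain ⟨L, hL⟩ := Φ.conewise_linear σ.1 σ.2
    refine ⟨⟨0, Fan.mem_support σ.2 (zero_mem _)⟩, zero_mem _, ?_⟩
    rw [hL _ (zero_mem _)]; simp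
  add_mem' := by
    obtain ⟨L, hL⟩ := Φ.conewise_linear σ.1 σ.2
    rintro _ _ ⟨x, hx, rfl⟩ ⟨y, hy, rfl⟩
    refine ⟨⟨x.1 + y.1, Fan.mem_support σ.2 (add_mem hx hy)⟩, add_mem hx hy, ?_⟩
    rw [hL _ hx, hL _ hy, hL _ (add_mem hx hy)]
    simp only [map_add]
    abel
  smul_mem' := by
    obtain ⟨L, hL⟩ := Φ.conewise_linear σ.1 σ.2
    rintro c _ ⟨x, hx, rfl⟩
    have hc : (c : ℝ) • x.1 ∈ σ.1 := Submodule.smul_mem σ.1 c hx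
    refine ⟨⟨(c : ℝ) • x.1, Fan.mem_support σ.2 hc⟩, hc, ?_⟩
    rw [hL _ hx, hL _ hc]
    change (c : ℝ) • (inlR NB NF x.1 + inrR NB NF (L.baseChange ℝ x.1)) = _
    simp only [map_smul, smul_add]

/-- The cone `σ̃ + τ` of the twisted product, where `σ̃` is the graph of `Φ` over `σ`. -/
def twistedCone (σ : FB.cones) (τ : PointedCone ℝ (RealSpace NF)) :
    PointedCone ℝ (RealSpace (NB × NF)) :=
  graphCone Φ σ ⊔ PointedCone.map (inrR NB NF) τ

lemma mem_twistedCone {σ : FB.cones} {τ : PointedCone ℝ (RealSpace NF)} {L : NB →ₗ[ℤ] NF}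
    (hL : ∀ x : FB.support, x.1 ∈ σ.1 → Φ.toFun x = L.baseChange ℝ x.1)
    {z : RealSpace (NB × NF)} :
    z ∈ twistedCone Φ σ τ ↔
      fstR NB NF z ∈ σ.1 ∧ sndR NB NF z - L.baseChange ℝ (fstR NB NF z) ∈ τ := by
  rw [twistedCone, Submodule.mem_sup]
  constructor
  · rintro ⟨_, ⟨x, hx, rfl⟩, _, ⟨y, hy, rfl⟩, rfl⟩
    rw [hL x hx]
    change _ ∈ _ ∧ sndR NB NF (_ + inrR NB NF y) -
      L.baseChange ℝ (fstR NB NF (_ + inrR NB NF y)) ∈ _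
    refine ⟨?_, ?_⟩
    · change fstR NB NF (_ + inrR NB NF y) ∈ _
      simpa using hx
    · simpa using hy
  · rintro ⟨h₁, h₂⟩
    refine ⟨_, ⟨⟨_, Fan.mem_support σ.2 h₁⟩, h₁, rfl⟩, _, ⟨_, h₂, rfl⟩, ?_⟩
    rw [hL _ h₁]
    change _ + inrR NB NF _ = _
    conv_rhs => rw [← inlR_fstR_add z]
    rw [map_sub]
    abel

lemma isFace_twistedCone {σ σ' : FB.cones} (hσ : IsFace σ'.1 σ.1)
    {τ τ' : PointedCone ℝ (RealSpace NF)} (hτ : IsFace τ' τ) :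
    IsFace (twistedCone Φ σ' τ') (twistedCone Φ σ τ) := by
  obtain ⟨L, hL⟩ := Φ.conewise_linear σ.1 σ.2
  obtain ⟨m, hm, hσ'⟩ := hσ
  obtain ⟨n, hn, hτ'⟩ := hτ
  have hL' : ∀ x : FB.support, x.1 ∈ σ'.1 → Φ.toFun x = L.baseChange ℝ x.1 :=
    fun x hx => hL x ((hσ' x.1).mp hx).1
  have key : ∀ z : RealSpace (NB × NF),
      pairing (m ∘ₗ LinearMap.fst ℤ NB NF + n ∘ₗ (LinearMap.snd ℤ NB NF -
        L ∘ₗ LinearMap.fst ℤ NB NF)) z = pairing m (fstR NB NF z) +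
        pairing n (sndR NB NF z - L.baseChange ℝ (fstR NB NF z)) := by
    intro z
    rw [pairing_add, ← pairing_baseChange, ← pairing_baseChange, LinearMap.baseChange_sub,
      LinearMap.baseChange_comp]
    rfl
  refine ⟨m ∘ₗ LinearMap.fst ℤ NB NF + n ∘ₗ (LinearMap.snd ℤ NB NF -
    L ∘ₗ LinearMap.fst ℤ NB NF), fun z hz => ?_, fun z => ?_⟩
  · rw [mem_twistedCone Φ hL] at hz
    rw [key]
    exact add_nonneg (hm _ hz.1) (hn _ hz.2)
  · rw [mem_twistedCone Φ hL, mem_twistedCone Φ hL', key, hσ', hτ']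
    constructor
    · rintro ⟨⟨h1, h2⟩, h3, h4⟩
      exact ⟨⟨h1, h3⟩, by rw [h2, h4, add_zero]⟩
    · rintro ⟨⟨h1, h3⟩, h⟩
      have := hm _ h1
      have := hn _ h3
      exact ⟨⟨h1, by linarith⟩, h3, by linarith⟩

/-- The twisted product `Σ_B ⋉_Φ Σ_F`: the fan in `N = N_B × N_F` with the cones `σ̃ + τ` for
`σ ∈ Σ_B` and `τ ∈ Σ_F`. -/
def twistedProduct : Fan (NB × NF) where
  cones := {C | ∃ σ : FB.cones, ∃ τ ∈ FF.cones, C = twistedCone Φ σ τ}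
  finite := by
    have h1 := FB.finite.to_subtype
    have h2 := FF.finite.to_subtype
    refine (Set.finite_range (fun p : FB.cones × FF.cones => twistedCone Φ p.1 p.2.1)).subset ?_
    rintro _ ⟨σ, τ, hτ, rfl⟩
    exact ⟨(σ, ⟨τ, hτ⟩), rfl⟩
  bot_mem := by
    refine ⟨⟨⊥, FB.bot_mem⟩, ⊥, FF.bot_mem, ?_⟩
    obtain ⟨L, hL⟩ := Φ.conewise_linear ⊥ FB.bot_mem
    ext z
    rw [mem_twistedCone Φ (σ := ⟨⊥, FB.bot_mem⟩) hL]
    constructor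
    · intro hz
      rw [Submodule.mem_bot] at hz
      subst hz
      simp
    · rintro ⟨h1, h2⟩
      rw [Submodule.mem_bot] at h1 h2
      rw [h1, map_zero, sub_zero] at h2
      rw [Submodule.mem_bot, ← inlR_fstR_add z, h1, h2, map_zero, map_zero, add_zero]
  rational := by
    rintro _ ⟨σ, τ, hτ, rfl⟩
    obtain ⟨L, hL⟩ := Φ.conewise_linear σ.1 σ.2
    have h : twistedCone Φ σ τ = PointedCone.map
        ((LinearMap.inl ℤ NB NF + LinearMap.inr ℤ NB NF ∘ₗ L).baseChange ℝ) σ.1 ⊔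
        PointedCone.map (inrR NB NF) τ := by
      rw [twistedCone]
      congr 1
      have e : ∀ x, (LinearMap.inl ℤ NB NF + LinearMap.inr ℤ NB NF ∘ₗ L).baseChange ℝ x =
          inlR NB NF x + inrR NB NF (L.baseChange ℝ x) := by
        intro x
        rw [LinearMap.baseChange_add, LinearMap.baseChange_comp]
        rfl
      ext z
      rw [PointedCone.mem_map]
      constructor
      · rintro ⟨x, hx, rfl⟩
        exact ⟨x.1, hx, by rw [e, hL x hx]⟩
      · rintro ⟨x, hx, rfl⟩
        exact ⟨⟨x, Fan.mem_support σ.2 hx⟩, hx, by rw [e, hL _ hx]⟩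
    rw [h]
    exact ((FB.rational _ σ.2).map _).sup ((FF.rational _ hτ).map _)
  salient := by
    rintro _ ⟨σ, τ, hτ, rfl⟩ z hz hz0 hneg
    obtain ⟨L, hL⟩ := Φ.conewise_linear σ.1 σ.2
    replace hz : z ∈ twistedCone Φ σ τ := hz
    replace hneg : -z ∈ twistedCone Φ σ τ := hneg
    rw [mem_twistedCone Φ hL] at hz hneg
    have h1 : fstR NB NF z = 0 := by
      by_contra h
      exact FB.salient _ σ.2 _ hz.1 h (by simpa using hneg.1)
    have h2 : sndR NB NF z = 0 := by
      by_contra h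
      refine FF.salient _ hτ (sndR NB NF z) ?_ h ?_
      · have := hz.2
        rw [h1, map_zero, sub_zero] at this
        exact this
      · have := hneg.2
        rw [map_neg, map_neg, h1, neg_zero, map_zero, sub_zero] at this
        exact this
    exact hz0 (by rw [← inlR_fstR_add z, h1, h2, map_zero, map_zero, add_zero])
  face_mem := by
    rintro _ ⟨σ, τ, hτ, rfl⟩ C ⟨m, hm, hC⟩
    obtain ⟨L, hL⟩ := Φ.conewise_linear σ.1 σ.2
    have key : ∀ z : RealSpace (NB × NF), pairing m z =
        pairing (m ∘ₗ (LinearMap.inl ℤ NB NF + LinearMap.inr ℤ NB NF ∘ₗ L)) (fstR NB NF z) +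
        pairing (m ∘ₗ LinearMap.inr ℤ NB NF)
          (sndR NB NF z - L.baseChange ℝ (fstR NB NF z)) := by
      intro z
      rw [← pairing_baseChange, ← pairing_baseChange, ← map_add, LinearMap.baseChange_add,
        LinearMap.baseChange_comp, map_sub]
      refine congrArg _ ?_
      conv_lhs => rw [← inlR_fstR_add z]
      simp only [LinearMap.add_apply, LinearMap.comp_apply, inlR, inrR]
      abel
    have hmB : ∀ x ∈ σ.1,
        0 ≤ pairing (m ∘ₗ (LinearMap.inl ℤ NB NF + LinearMap.inr ℤ NB NF ∘ₗ L)) x := by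
      intro x hx
      have := hm (inlR NB NF x + inrR NB NF (L.baseChange ℝ x)) (by
        rw [mem_twistedCone Φ hL]; simpa using hx)
      rw [key] at this
      simpa using this
    have hmF : ∀ y ∈ τ, 0 ≤ pairing (m ∘ₗ LinearMap.inr ℤ NB NF) y := by
      intro y hy
      have := hm (inrR NB NF y) (by rw [mem_twistedCone Φ hL]; simpa using hy)
      rw [key] at this
      simpa using this
    have fB := isFace_cut hmB
    have fF := isFace_cut hmF
    refine ⟨⟨_, FB.face_mem _ σ.2 _ fB⟩, _, FF.face_mem _ hτ _ fF, ?_⟩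
    ext z
    rw [hC, mem_twistedCone Φ hL, mem_twistedCone Φ
      (σ := ⟨_, FB.face_mem _ σ.2 _ fB⟩) (L := L) (fun x hx => hL x hx.1), key]
    constructor
    · rintro ⟨⟨h1, h2⟩, h3⟩
      have := hmB _ h1
      have := hmF _ h2
      exact ⟨⟨h1, show _ = _ by linarith⟩, ⟨h2, show _ = _ by linarith⟩⟩
    · rintro ⟨⟨h1, h3⟩, ⟨h2, h4⟩⟩
      refine ⟨⟨h1, h2⟩, ?_⟩
      have h3 : pairing _ _ = 0 := h3
      have h4 : pairing _ _ = 0 := h4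
      rw [h3, h4, add_zero]
  inf_isFace := by
    rintro _ ⟨σ, τ, hτ, rfl⟩ _ ⟨σ', τ', hτ', rfl⟩
    have h : twistedCone Φ σ τ ⊓ twistedCone Φ σ' τ' =
        twistedCone Φ ⟨σ.1 ⊓ σ'.1, FB.inf_mem σ.2 σ'.2⟩ (τ ⊓ τ') := by
      obtain ⟨L, hL⟩ := Φ.conewise_linear σ.1 σ.2
      obtain ⟨L', hL'⟩ := Φ.conewise_linear σ'.1 σ'.2
      ext z
      rw [Submodule.mem_inf, mem_twistedCone Φ hL, mem_twistedCone Φ hL',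
        mem_twistedCone Φ (σ := ⟨σ.1 ⊓ σ'.1, FB.inf_mem σ.2 σ'.2⟩) (L := L)
          (fun x hx => hL x hx.1)]
      have e : fstR NB NF z ∈ σ.1 → fstR NB NF z ∈ σ'.1 →
          L.baseChange ℝ (fstR NB NF z) = L'.baseChange ℝ (fstR NB NF z) := fun h1 h2 =>
        (hL ⟨_, Fan.mem_support σ.2 h1⟩ h1).symm.trans (hL' ⟨_, Fan.mem_support σ.2 h1⟩ h2)
      constructor
      · rintro ⟨⟨h1, h2⟩, h3, h4⟩
        exact ⟨⟨h1, h3⟩, h2, by rw [e h1 h3]; exact h4⟩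
      · rintro ⟨⟨h1, h3⟩, h2, h4⟩
        exact ⟨⟨h1, h2⟩, h3, by rw [← e h1 h3]; exact h4⟩
    rw [h]
    exact isFace_twistedCone Φ (FB.inf_isFace _ σ.2 _ σ'.2) (FF.inf_isFace _ hτ _ hτ')

/-- The projection `N → N_B` is a map of fans `Σ_B ⋉_Φ Σ_F → Σ_B`. -/
lemma isFanMap_fst : IsFanMap (LinearMap.fst ℤ NB NF) (twistedProduct FF Φ) FB := by
  rintro _ ⟨σ, τ, hτ, rfl⟩
  obtain ⟨L, hL⟩ := Φ.conewise_linear σ.1 σ.2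
  exact ⟨σ.1, σ.2, fun z hz => ((mem_twistedCone Φ hL).mp hz).1⟩

/-- `U_{σ̃ + τ} = U_σ × U_τ`. -/
lemma isPullback_twistedCone (σ : FB.cones) (τ : PointedCone ℝ (RealSpace NF))
    {L : NB →ₗ[ℤ] NF} (hL : ∀ x : FB.support, x.1 ∈ σ.1 → Φ.toFun x = L.baseChange ℝ x.1)
    (h₁ : MapsCone (LinearMap.fst ℤ NB NF) (twistedCone Φ σ τ) σ.1)
    (h₂ : MapsCone (LinearMap.snd ℤ NB NF - L ∘ₗ LinearMap.fst ℤ NB NF) (twistedCone Φ σ τ) τ) :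
    IsPullback (chartMap _ h₁) (chartMap _ h₂)
      (Spec.map (CommRingCat.ofHom (algebraMap ℂ (chartRing σ.1))))
      (Spec.map (CommRingCat.ofHom (algebraMap ℂ (chartRing τ)))) := by
  have g₁ : MapsCone (LinearMap.inl ℤ NB NF + LinearMap.inr ℤ NB NF ∘ₗ L) σ.1
      (twistedCone Φ σ τ) := by
    intro x hx
    have e : (LinearMap.inl ℤ NB NF + LinearMap.inr ℤ NB NF ∘ₗ L).baseChange ℝ x =
        inlR NB NF x + inrR NB NF (L.baseChange ℝ x) := by
      rw [LinearMap.baseChange_add, LinearMap.baseChange_comp]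
      rfl
    rw [e, mem_twistedCone Φ hL]
    simpa using hx
  have g₂ : MapsCone (LinearMap.inr ℤ NB NF) τ (twistedCone Φ σ τ) := by
    intro y hy
    change inrR NB NF y ∈ _
    rw [mem_twistedCone Φ hL]
    simpa using hy
  refine isPullback_SpecMap_of_isPushout _ _ _ _ (isPushout_monoidAlgebra
    (semigroupMap _ h₁) (semigroupMap _ h₂) (semigroupMap _ g₁) (semigroupMap _ g₂)
    ?_ ?_ ?_ ?_ ?_)
  · intro m
    refine Subtype.ext (LinearMap.ext fun v => ?_)
    simp [semigroupMap]
  · intro m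
    refine Subtype.ext (LinearMap.ext fun v => ?_)
    simp [semigroupMap]
  · intro m
    refine Subtype.ext (LinearMap.ext fun v => ?_)
    simp [semigroupMap]
  · intro m
    refine Subtype.ext (LinearMap.ext fun v => ?_)
    simp [semigroupMap]
  · intro m
    refine Subtype.ext (LinearMap.ext fun v => ?_)
    change m.1 _ + m.1 _ = m.1 v
    rw [← map_add]
    congr 1
    ext <;> simp

/-- The projection of a twisted product is a locally trivial bundle with fibre `X_{Σ_F}`. -/
theorem isFibreBundle_twistedProduct :
    IsFibreBundle (toricMap (LinearMap.fst ℤ NB NF) (isFanMap_fst FF Φ))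
      FB.structureMap FF.structureMap := by
  refine IsFibreBundle.of_isPullback fun b => ?_
  obtain ⟨σ, y, rfl⟩ := FB.exists_chartIncl b
  obtain ⟨L, hL⟩ := Φ.conewise_linear σ.1 σ.2
  set W := (twistedProduct FF Φ).preimage (LinearMap.fst ℤ NB NF) σ.1 with hW
  have e : ∀ z, (LinearMap.snd ℤ NB NF - L ∘ₗ LinearMap.fst ℤ NB NF).baseChange ℝ z =
      sndR NB NF z - L.baseChange ℝ (fstR NB NF z) := by
    intro z
    rw [LinearMap.baseChange_sub, LinearMap.baseChange_comp]
    rfl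
  have hq : IsFanMap (LinearMap.snd ℤ NB NF - L ∘ₗ LinearMap.fst ℤ NB NF) W FF := by
    rintro _ ⟨⟨ρ, τ, hτ, rfl⟩, hρ⟩
    refine ⟨τ, hτ, fun z hz => ?_⟩
    have hL' : ∀ x : FB.support, x.1 ∈ ρ.1 → Φ.toFun x = L.baseChange ℝ x.1 := by
      intro x hx
      obtain ⟨L', hL'⟩ := Φ.conewise_linear ρ.1 ρ.2
      refine hL x ?_
      have := hρ (inlR NB NF x.1 + inrR NB NF (L'.baseChange ℝ x.1)) (by
        rw [mem_twistedCone Φ hL']; simpa using hx)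
      change fstR NB NF _ ∈ _ at this
      simpa using this
    rw [e]
    exact ((mem_twistedCone Φ hL').mp hz).2
  refine ⟨_, _, FB.chartIncl σ, _, _, toricMap _ hq, inferInstance, ⟨y, rfl⟩,
    isPullback_preimage _ (isFanMap_fst FF Φ) σ, ?_⟩
  have hj : FB.chartIncl σ ≫ FB.structureMap =
      Spec.map (CommRingCat.ofHom (algebraMap ℂ (chartRing σ.1))) := Fan.chartIncl_glue _ _ _ _
  have hF : ∀ τ, FF.chartIncl τ ≫ FF.structureMap =
      Spec.map (CommRingCat.ofHom (algebraMap ℂ (chartRing τ.1))) := fun τ =>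
    Fan.chartIncl_glue _ _ _ _
  rw [hj]
  have h₁ : ∀ τ, MapsCone (LinearMap.fst ℤ NB NF) (twistedCone Φ σ τ) σ.1 := fun τ z hz =>
    ((mem_twistedCone Φ hL).mp hz).1
  have h₂ : ∀ τ, MapsCone (LinearMap.snd ℤ NB NF - L ∘ₗ LinearMap.fst ℤ NB NF)
      (twistedCone Φ σ τ) τ := fun τ z hz => by
    rw [e]; exact ((mem_twistedCone Φ hL).mp hz).2
  have hP := fun τ => isPullback_twistedCone Φ σ τ hL (h₁ τ) (h₂ τ)
  let C : FF.cones → W.cones := fun τ => ⟨twistedCone Φ σ τ.1, ⟨σ, τ.1, τ.2, rfl⟩, h₁ τ.1⟩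
  have hCa : ∀ τ, W.chartIncl (C τ) ≫ preimageToChart (twistedProduct FF Φ)
      (LinearMap.fst ℤ NB NF) σ.1 = chartMap _ (h₁ τ.1) := fun τ => Fan.chartIncl_glue _ _ _ _
  have hmax : ∀ (τ : FF.cones), ∀ D ∈ W.cones,
      MapsCone (LinearMap.snd ℤ NB NF - L ∘ₗ LinearMap.fst ℤ NB NF) D τ.1 → D ≤ (C τ).1 := by
    intro τ D hD hDτ z hz
    refine (mem_twistedCone Φ hL).mpr ⟨hD.2 z hz, ?_⟩
    rw [← e]
    exact hDτ z hz
  have H : ∀ τ : FF.cones, IsPullback (W.chartIncl (C τ) ≫ preimageToChart (twistedProduct FF Φ)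
      (LinearMap.fst ℤ NB NF) σ.1) (chartMap _ (h₂ τ.1))
      (Spec.map (CommRingCat.ofHom (algebraMap ℂ (chartRing σ.1))))
      (FF.chartIncl τ ≫ FF.structureMap) := by
    intro τ
    rw [hCa, hF]
    exact hP τ.1
  refine isPullback_of_openCover ?_ FF.openCover (fun τ => chart (C τ).1)
    (fun τ => W.chartIncl (C τ)) (fun τ => chartMap _ (h₂ τ.1)) (fun τ => ?_) (fun τ => ?_)
  · rw [toricMap_structureMap]
    refine Fan.hom_ext _ fun D => ?_
    rw [← Category.assoc, preimageToChart, Fan.chartIncl_glue, chartMap_algebraMap,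
      Fan.chartIncl_structureMap]
  · exact isPullback_chart _ hq (C τ) τ (h₂ τ.1) (hmax τ)
  · exact H τ

variable (FB) in
/-- A fibered toric variety over `X_{Σ_B}` with fibre `X_{Σ_F}`: the toric variety of a fan in
`N = N_B × N_F` (so that its torus is `T = T_B × T_F`) for which the projection `N → N_B` is a
map of fans and the induced toric morphism `π : X_Σ → X_{Σ_B}` is a fibre bundle with fibre
`X_{Σ_F}`. -/
structure FiberedToricVariety where
  fan : Fan (NB × NF)
  isFanMap : IsFanMap (LinearMap.fst ℤ NB NF) fan FB
  isFibreBundle : IsFibreBundle (toricMap (LinearMap.fst ℤ NB NF) isFanMap)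
    FB.structureMap FF.structureMap

/-- The projection `π : X_Σ → X_{Σ_B}` of a fibered toric variety. -/
def FiberedToricVariety.proj {FF : Fan NF} (E : FiberedToricVariety FB FF) :
    E.fan.toricVariety ⟶ FB.toricVariety :=
  toricMap (LinearMap.fst ℤ NB NF) E.isFanMap

/-- The fibered toric variety of the twisted product `Σ_B ⋉_Φ Σ_F`. -/
def twistedBundle : FiberedToricVariety FB FF where
  fan := twistedProduct FF Φ
  isFanMap := isFanMap_fst FF Φ
  isFibreBundle := isFibreBundle_twistedProduct FF Φ

/-- An isomorphism of fibered toric varieties over `X_{Σ_B}`: an isomorphism of schemes over `ℂ`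
that commutes with the projections to `X_{Σ_B}` and is toric, i.e. it restricts to the
isomorphism of the torus `T` given by an automorphism of the lattice `N`, and it is equivariant
along this isomorphism. -/
structure FiberedToricIso {FF : Fan NF} (E E' : FiberedToricVariety FB FF) where
  iso : E.fan.toricVariety ≅ E'.fan.toricVariety
  over_complex : iso.hom ≫ E'.fan.structureMap = E.fan.structureMap
  over_base : iso.hom ≫ E'.proj = E.proj
  lattice : (NB × NF) ≃ₗ[ℤ] (NB × NF)
  on_torus : torusIncl E.fan ≫ iso.hom = torusMap lattice.toLinearMap ≫ torusIncl E'.fan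
  equivariant : ∀ t : TorusPoint (NB × NF),
    torusAct E.fan t ≫ iso.hom = iso.hom ≫ torusAct E'.fan (t.map lattice.toLinearMap)

/-- The automorphism `(v₁, v₂) ↦ (v₁, v₂ + φ(v₁))` of the lattice `N = N_B × N_F`. -/
def shear (φ : NB →ₗ[ℤ] NF) : (NB × NF) ≃ₗ[ℤ] (NB × NF) where
  toFun v := (v.1, v.2 + φ v.1)
  invFun v := (v.1, v.2 - φ v.1)
  map_add' v w := by ext <;> simp; abel
  map_smul' c v := by ext <;> simp
  left_inv v := by simp
  right_inv v := by simp

end Twisted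

end Toric

end

/-!
The shear `(v₁, v₂) ↦ (v₁, v₂ + φ v₁)` carries the graph point `(x, Φ x)` to `(x, Φ' x)` and fixes
`{0} × (N_F)_ℝ`, so it carries each cone `σ̃ + τ` of `Σ` onto the corresponding cone of `Σ'`; the
shear by `-φ` carries it back. Since `X_Σ` is functorial in the fan, the shear induces an
isomorphism, which lies over `X_{Σ_B}` because the shear preserves the projection to `N_B`. Its
compatibility with the torus and the torus action holds for every toric morphism.
-/

noncomputable section

namespace Toric

section Functoriality

variable {N N' N'' : Type} [AddCommGroup N] [AddCommGroup N'] [AddCommGroup N'']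
variable {F : Fan N} {F' : Fan N'} {F'' : Fan N''}

lemma mapsCone_bot (φ : N →ₗ[ℤ] N') (σ' : PointedCone ℝ (RealSpace N')) :
    MapsCone φ ⊥ σ' := by
  intro x hx
  rw [(Submodule.mem_bot _).1 hx, map_zero]
  exact zero_mem σ'

lemma IsFanMap.comp {φ : N →ₗ[ℤ] N'} {ψ : N' →ₗ[ℤ] N''} (hφ : IsFanMap φ F F')
    (hψ : IsFanMap ψ F' F'') : IsFanMap (ψ ∘ₗ φ) F F'' := by
  intro σ hσ
  obtain ⟨σ', hσ', hσσ'⟩ := hφ σ hσ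
  obtain ⟨σ'', hσ'', hσ'σ''⟩ := hψ σ' hσ'
  exact ⟨σ'', hσ'', hσσ'.comp hσ'σ''⟩

lemma toricMap_id (h : IsFanMap LinearMap.id F F) :
    toricMap LinearMap.id h = 𝟙 F.toricVariety := by
  refine F.hom_ext fun σ => ?_
  rw [chartIncl_toricMap _ h σ σ (MapsCone.of_le le_rfl), chartMap_id, Category.id_comp,
    Category.comp_id]

lemma toricMap_comp {φ : N →ₗ[ℤ] N'} {ψ : N' →ₗ[ℤ] N''} (hφ : IsFanMap φ F F')
    (hψ : IsFanMap ψ F' F'') :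
    toricMap φ hφ ≫ toricMap ψ hψ = toricMap (ψ ∘ₗ φ) (hφ.comp hψ) := by
  refine F.hom_ext fun σ => ?_
  obtain ⟨σ', hσ', hσσ'⟩ := hφ σ.1 σ.2
  obtain ⟨σ'', hσ'', hσ'σ''⟩ := hψ σ' hσ'
  rw [reassoc_of% (chartIncl_toricMap φ hφ σ ⟨σ', hσ'⟩ hσσ'),
    chartIncl_toricMap ψ hψ ⟨σ', hσ'⟩ ⟨σ'', hσ''⟩ hσ'σ'',
    chartIncl_toricMap _ (hφ.comp hψ) σ ⟨σ'', hσ''⟩ (hσσ'.comp hσ'σ''),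
    ← chartMap_comp hσσ' hσ'σ'', Category.assoc]

/-- The isomorphism of toric varieties induced by an isomorphism of lattices that is a map of fans
in both directions. -/
def toricIso (α : N ≃ₗ[ℤ] N') (h : IsFanMap α.toLinearMap F F')
    (hsymm : IsFanMap α.symm.toLinearMap F' F) : F.toricVariety ≅ F'.toricVariety where
  hom := toricMap α.toLinearMap h
  inv := toricMap α.symm.toLinearMap hsymm
  hom_inv_id := by simp only [toricMap_comp, LinearEquiv.symm_comp, toricMap_id]
  inv_hom_id := by simp only [toricMap_comp, LinearEquiv.comp_symm, toricMap_id]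

/-- The inclusion `T_N → U_σ` of the torus in an affine chart, dual to `ℂ[S_σ] ⊆ ℂ[M]`. -/
def torusToChart (σ : PointedCone ℝ (RealSpace N)) : torus N ⟶ chart σ :=
  Spec.map (CommRingCat.ofHom (AddMonoidAlgebra.mapDomainRingHom ℂ (semigroup σ).subtype))

lemma torusToChart_chartMap (φ : N →ₗ[ℤ] N') {σ : PointedCone ℝ (RealSpace N)}
    {σ' : PointedCone ℝ (RealSpace N')} (h : MapsCone φ σ σ') :
    torusToChart σ ≫ chartMap φ h = torusMap φ ≫ torusToChart σ' := by
  simp only [torusToChart, chartMap, torusMap, ← Spec.map_comp, ← CommRingCat.ofHom_comp,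
    ← AddMonoidAlgebra.mapDomainRingHom_comp]
  rfl

lemma torusIncl_toricMap (φ : N →ₗ[ℤ] N') (h : IsFanMap φ F F') :
    torusIncl F ≫ toricMap φ h = torusMap φ ≫ torusIncl F' := by
  change (torusToChart ⊥ ≫ _) ≫ _ = _ ≫ torusToChart ⊥ ≫ _
  rw [Category.assoc, chartIncl_toricMap φ h ⟨⊥, F.bot_mem⟩ ⟨⊥, F'.bot_mem⟩ (mapsCone_bot φ ⊥),
    reassoc_of% (torusToChart_chartMap φ (mapsCone_bot φ ⊥))]

lemma chartIncl_torusAct (t : TorusPoint N) (σ : F.cones) :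
    F.chartIncl σ ≫ torusAct F t = chartAct t σ.1 ≫ F.chartIncl σ :=
  F.chartIncl_glue _ _ _

lemma torusAct_toricMap (φ : N →ₗ[ℤ] N') (h : IsFanMap φ F F') (t : TorusPoint N) :
    torusAct F t ≫ toricMap φ h = toricMap φ h ≫ torusAct F' (t.map φ) := by
  refine F.hom_ext fun σ => ?_
  obtain ⟨σ', hσ', hσσ'⟩ := h σ.1 σ.2
  have hincl := chartIncl_toricMap φ h σ ⟨σ', hσ'⟩ hσσ'
  rw [reassoc_of% (chartIncl_torusAct t σ), reassoc_of% hincl, hincl, chartIncl_torusAct,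
    reassoc_of% (chartMap_chartAct t φ hσσ')]

end Functoriality

section Fibered

variable {NB NF : Type} [AddCommGroup NB] [AddCommGroup NF] {FB : Fan NB} {FF : Fan NF}

/-- The isomorphism of fibered toric varieties induced by an automorphism of `N_B × N_F` over `N_B`
that is a map of fans in both directions. -/
def FiberedToricIso.ofLatticeEquiv {E E' : FiberedToricVariety FB FF}
    (α : (NB × NF) ≃ₗ[ℤ] (NB × NF)) (h : IsFanMap α.toLinearMap E.fan E'.fan)
    (hsymm : IsFanMap α.symm.toLinearMap E'.fan E.fan)
    (hfst : LinearMap.fst ℤ NB NF ∘ₗ α.toLinearMap = LinearMap.fst ℤ NB NF) :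
    FiberedToricIso E E' where
  iso := toricIso α h hsymm
  over_complex := toricMap_structureMap _ h
  over_base := by simp only [toricIso, FiberedToricVariety.proj, toricMap_comp, hfst]
  lattice := α
  on_torus := torusIncl_toricMap _ h
  equivariant := torusAct_toricMap _ h

end Fibered

section Shear

variable {NB NF : Type} [AddCommGroup NB] [AddCommGroup NF] (φ : NB →ₗ[ℤ] NF)

lemma shear_symm : (shear φ).symm = shear (-φ) :=
  LinearEquiv.ext fun v => Prod.ext rfl (sub_eq_add_neg v.2 (φ v.1))

lemma fst_comp_shear :
    LinearMap.fst ℤ NB NF ∘ₗ (shear φ).toLinearMap = LinearMap.fst ℤ NB NF :=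
  rfl

lemma shear_comp_inl :
    (shear φ).toLinearMap ∘ₗ LinearMap.inl ℤ NB NF =
      LinearMap.inl ℤ NB NF + LinearMap.inr ℤ NB NF ∘ₗ φ := by
  ext <;> simp [shear]

lemma shear_comp_inr :
    (shear φ).toLinearMap ∘ₗ LinearMap.inr ℤ NB NF = LinearMap.inr ℤ NB NF := by
  ext <;> simp [shear]

lemma baseChange_shear_inlR (x : RealSpace NB) :
    (shear φ).toLinearMap.baseChange ℝ (inlR NB NF x) =
      inlR NB NF x + inrR NB NF (φ.baseChange ℝ x) := by
  simp only [inlR, inrR, ← LinearMap.comp_apply, ← LinearMap.baseChange_comp, shear_comp_inl,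
    LinearMap.baseChange_add, LinearMap.add_apply]

lemma baseChange_shear_comp_inrR :
    (shear φ).toLinearMap.baseChange ℝ ∘ₗ inrR NB NF = inrR NB NF := by
  rw [inrR, ← LinearMap.baseChange_comp, shear_comp_inr]

variable {φ} {FB : Fan NB} {Φ Φ' : TwistingMap NF FB}
  (hφ : ∀ x : FB.support, Φ'.toFun x = Φ.toFun x + φ.baseChange ℝ x.1)

include hφ

lemma baseChange_shear_graph (x : FB.support) :
    (shear φ).toLinearMap.baseChange ℝ (inlR NB NF x.1 + inrR NB NF (Φ.toFun x)) =
      inlR NB NF x.1 + inrR NB NF (Φ'.toFun x) := by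
  have hfix : (shear φ).toLinearMap.baseChange ℝ (inrR NB NF (Φ.toFun x)) =
      inrR NB NF (Φ.toFun x) :=
    LinearMap.congr_fun (baseChange_shear_comp_inrR φ) _
  rw [map_add, baseChange_shear_inlR, hfix, hφ, map_add]
  abel

lemma map_shear_graphCone (σ : FB.cones) :
    PointedCone.map ((shear φ).toLinearMap.baseChange ℝ) (graphCone Φ σ) = graphCone Φ' σ := by
  ext z
  constructor
  · rintro ⟨_, ⟨x, hx, rfl⟩, rfl⟩
    exact ⟨x, hx, baseChange_shear_graph hφ x⟩
  · rintro ⟨x, hx, rfl⟩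
    exact ⟨_, ⟨x, hx, rfl⟩, baseChange_shear_graph hφ x⟩

lemma map_shear_twistedCone (σ : FB.cones) (τ : PointedCone ℝ (RealSpace NF)) :
    PointedCone.map ((shear φ).toLinearMap.baseChange ℝ) (twistedCone Φ σ τ) =
      twistedCone Φ' σ τ := by
  rw [twistedCone, twistedCone, PointedCone.map, Submodule.map_sup]
  change PointedCone.map _ _ ⊔ PointedCone.map _ _ = _
  rw [map_shear_graphCone hφ, PointedCone.map_map, baseChange_shear_comp_inrR]

lemma isFanMap_shear (FF : Fan NF) :
    IsFanMap (shear φ).toLinearMap (twistedProduct FF Φ) (twistedProduct FF Φ') := by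
  rintro _ ⟨σ, τ, hτ, rfl⟩
  exact ⟨_, ⟨σ, τ, hτ, rfl⟩, fun z hz =>
    map_shear_twistedCone hφ σ τ ▸ Submodule.mem_map_of_mem hz⟩

lemma isFanMap_shear_symm (FF : Fan NF) :
    IsFanMap (shear φ).symm.toLinearMap (twistedProduct FF Φ') (twistedProduct FF Φ) := by
  rw [shear_symm]
  refine isFanMap_shear (fun x => ?_) FF
  rw [hφ, LinearMap.baseChange_neg, LinearMap.neg_apply, add_neg_cancel_right]

end Shear

end Toric

end

theorem proposition2p3_general {NB NF : Type} [AddCommGroup NB] [AddCommGroup NF]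
    (FB : Toric.Fan NB) (FF : Toric.Fan NF) (Φ Φ' : Toric.TwistingMap NF FB)
    (φ : NB →ₗ[ℤ] NF)
    (hφ : ∀ x : FB.support, Φ'.toFun x = Φ.toFun x + φ.baseChange ℝ x.1) :
    ∃ h : Toric.IsFanMap (Toric.shear φ).toLinearMap
        (Toric.twistedProduct FF Φ) (Toric.twistedProduct FF Φ'),
      ∃ e : Toric.FiberedToricIso (Toric.twistedBundle FF Φ) (Toric.twistedBundle FF Φ'),
        e.lattice = Toric.shear φ ∧
        e.iso.hom = Toric.toricMap (Toric.shear φ).toLinearMap h :=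
  have hshear := Toric.isFanMap_shear hφ FF
  have hsymm := Toric.isFanMap_shear_symm hφ FF
  ⟨hshear, .ofLatticeEquiv (Toric.shear φ) hshear hsymm (Toric.fst_comp_shear φ), rfl, rfl⟩

theorem proposition2p3 {NB NF : Type}
    [AddCommGroup NB] [Module.Free ℤ NB] [Module.Finite ℤ NB]
    [AddCommGroup NF] [Module.Free ℤ NF] [Module.Finite ℤ NF]
    (FB : Toric.Fan NB) (FF : Toric.Fan NF) (Φ Φ' : Toric.TwistingMap NF FB)
    (φ : NB →ₗ[ℤ] NF)
    (hφ : ∀ x : FB.support, Φ'.toFun x = Φ.toFun x + φ.baseChange ℝ x.1) :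
    ∃ h : Toric.IsFanMap (Toric.shear φ).toLinearMap
        (Toric.twistedProduct FF Φ) (Toric.twistedProduct FF Φ'),
      ∃ e : Toric.FiberedToricIso (Toric.twistedBundle FF Φ) (Toric.twistedBundle FF Φ'),
        e.lattice = Toric.shear φ ∧
        e.iso.hom = Toric.toricMap (Toric.shear φ).toLinearMap h :=
  proposition2p3_general FB FF Φ Φ' φ hφ
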